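/- **Setting.** Let $\mathcal H_C=\mathbb C^d$ (the clockwork, $d\ge 1$) and let $\mathcal H_R$ (the register) have orthonormal basis $|0\rangle,\dots,|N_T\rangle$, $N_T\ge 1$. Let $(\mathcal M^t)_{t\ge 0}$ be a family of linear maps on $\mathcal B(\mathcal H_C\otimes\mathcal H_R)$, and write $\mathcal M^{t,k}(X):=\mathcal M^t(X\otimes|k\rangle\langle k|)$ for $X\in\mathcal B(\mathcal H_C)$ and $k=0,\dots,N_T$. Let $\tilde p^{(k)}_l(t)=\mathrm{tr}\big[\mathcal M^{t,k}(\rho_C)\,|l\rangle\langle l|\big]$, where $\rho_C$ is a state on $\mathcal H_C$. Consider the following conditions, to hold for all states $\rho_C$ on $\mathcal H_C$: 1. for all $t\ge0$, all $k,k'$ and all $l\in\mathbb Z$, $\mathrm{tr}_R[\mathcal M^{t,k}(\rho_C)|k+l\rangle\langle k+l|]=\mathrm{tr}_R[\mathcal M^{t,k'}(\rho_C)|k'+l\rangle\langle k'+l|]$, with register labels taken modulo $N_T+1$; 2. $\mathcal M^{t_1+t_2}=\mathcal M^{t_2}\circ\mathcal M^{t_1}$ for all $t_1,t_2\ge0$;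 3. $\mathcal M^0=\mathrm{id}$ and $\lim_{t\to0^+}\|\mathcal M^t-\mathrm{id}\|=0$; 4. for all $k$, with $f(k)=k+1$ modulo $N_T+1$: $\sum_{l\notin\{k,f(k)\}}\tilde p_l^{(k)}(t)=o\big(\tilde p^{(k)}_{f(k)}(t)\big)$ as $t\to0^+$; 5. there is a family of channels $(\tilde{\mathcal M}^t)_{t\ge0}$ satisfying 1–4 (an *underlying periodic clock*) such that, as $t\to0^+$, $\mathcal M^{t,k}(\rho_C)=\tilde{\mathcal M}^{t,k}(\rho_C)+o(t)$ for $k=0,\dots,N_T-1$; moreover $\mathrm{tr}_C[\mathcal M^{t,N_T}(\rho_C)]=|N_T\rangle\langle N_T|+o(t)$. A *ticking clock* is a pair of a state $\rho^0_{CR}$ on $\mathcal H_C\otimes\mathcal H_R$ and a family of quantum channels (completely positive trace-preserving maps) $(\mathcal M^t)_{t\ge0}$ satisfying conditions 1–4 (periodic register) or conditions 2 and 5 (cut-off register). It has a *classical register* if for all $t\ge0$, all $k$ and all states $\rho_C$, $\mathcal M^{t,k}(\rho_C)=\sum_{n=0}^{N_T}\rho^{(n;k)}(t)\otimes|n\rangle\langle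 n|$ with subnormalised states $\rho^{(n;k)}(t)$. Two families with a cut-off register are *clockwork equivalent* if they have a common underlying periodic clock; their clockwork states for the register input $|N_T\rangle\langle N_T|$ may differ. For a Hermitian operator $H$ and finite sequences $(L_j)_{j=1}^{m}$, $(J_j)_{j=1}^{m}$ of operators on $\mathcal H_C$ (all independent of $t$), let $$\mathcal L(X)=-\mathrm i[\tilde H,X]+\sum_{j=1}^m\Big(\tilde L_jX\tilde L_j^\dagger-\tfrac12\{\tilde L_j^\dagger\tilde L_j,X\}\Big)+\sum_{j=1}^m\Big(\tilde J_jX\tilde J_j^\dagger-\tfrac12\{\tilde J_j^\dagger\tilde J_j,X\}\Big),$$ $\tilde H=H\otimes 1$, $\tilde L_j=L_j\otimes 1$, $\tilde J_j=J_j\otimes O^{(l)}$, with $O^{(l)}=\sum_{k=0}^{N_T-1}|k+1\rangle\langle k|+l\,|0\rangle\langle N_T|$, where $l=1$ for a periodic register and $l=0$ for a cut-off register. **Proposition (Explicit ticking clock representation).** Let $\rho^0_{CR}$ be a state on $\mathcal H_C\otimes\mathcal H_R$. For each of the two kinds of register: (if) If there are $m$, a Hermitian $H$, $(L_j)_{j=1}^m$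 and $(J_j)_{j=1}^m$ with $\mathcal M^t=e^{t\mathcal L}$ for all $t\ge0$, then $(\rho^0_{CR},(\mathcal M^t)_{t\ge0})$ is a ticking clock with a classical register. (only if) If $(\rho^0_{CR},(\mathcal M^t)_{t\ge0})$ is a ticking clock with a classical register, then there are $m$, a Hermitian $H$, $(L_j)_{j=1}^m$ and $(J_j)_{j=1}^m$ such that the dynamics is that of $e^{t\mathcal L}$, in the following sense. * Periodic register: $\mathcal M^{t,k}(X)=e^{t\mathcal L}(X\otimes|k\rangle\langle k|)$ for all $t\ge0$, $k=0,\dots,N_T$ and $X\in\mathcal B(\mathcal H_C)$. * Cut-off register: the same up to clockwork equivalence, that is, $(\mathcal M^t)$ and $(e^{t\mathcal L})$ are clockwork equivalent and, for all $t\ge0$, $k=0,\dots,N_T$ and $X\in\mathcal B(\mathcal H_C)$, $\mathrm{tr}_R[\mathcal M^{t,k}(X)|n\rangle\langle n|]=\mathrm{tr}_R[e^{t\mathcal L}(X\otimes|k\rangle\langle k|)|n\rangle\langle n|]$ for $n=0,\dots,N_T-1$, and $\mathrm{tr}_C[\mathcal M^{t,k}(X)]=\mathrm{tr}_C[e^{t\mathcal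 L}(X\otimes|k\rangle\langle k|)]$. -/

import Mathlib

open scoped Kronecker Topology ComplexOrder Matrix.Norms.L2Operator
open Matrix Filter Asymptotics

namespace TickingClock

noncomputable section

/-- Operators on the finite-dimensional Hilbert space with orthonormal basis indexed by `ι`. -/
abbrev Op (ι : Type) : Type := Matrix ι ι ℂ

/-- Basis labels of `H_C ⊗ H_R`: the clockwork has dimension `d`, the register has the
`N + 1` basis states `|0⟩, …, |N⟩`. Addition in `Fin (N + 1)` is addition modulo `N + 1`. -/
abbrev CR (d N : ℕ) : Type := Fin d × Fin (N + 1)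

/-- Linear maps (superoperators) on operators, with the operator norm. All norms on these
finite-dimensional spaces are equivalent. -/
abbrev SuperOp (ι : Type) [Fintype ι] : Type := Op ι →L[ℂ] Op ι

/-- Density operators. -/
structure IsState {ι : Type} [Fintype ι] (ρ : Op ι) : Prop where
  posSemidef : ρ.PosSemidef
  trace_eq_one : ρ.trace = 1

/-- Subnormalised states. -/
structure IsSubState {ι : Type} [Fintype ι] (ρ : Op ι) : Prop where
  posSemidef : ρ.PosSemidef
  trace_le_one : ρ.trace.re ≤ 1

/-- The ampliation `Φ ⊗ id` of a superoperator by an `n`-dimensional ancilla. -/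
def ampliate {ι : Type} [Fintype ι] (Φ : SuperOp ι) (n : ℕ) (X : Op (ι × Fin n)) :
    Op (ι × Fin n) :=
  Matrix.of fun p q => Φ (Matrix.of fun a b => X (a, p.2) (b, q.2)) p.1 q.1

/-- Quantum channels: completely positive trace-preserving maps. -/
structure IsChannel {ι : Type} [Fintype ι] (Φ : SuperOp ι) : Prop where
  completelyPositive : ∀ (n : ℕ) (X : Op (ι × Fin n)),
    X.PosSemidef → (ampliate Φ n X).PosSemidef
  tracePreserving : ∀ X : Op ι, (Φ X).trace = X.trace

/-- The register projector `|k⟩⟨k|`. -/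
def proj {N : ℕ} (k : Fin (N + 1)) : Op (Fin (N + 1)) := Matrix.single k k 1

/-- Partial trace over the register. -/
def ptraceR {d N : ℕ} (X : Op (CR d N)) : Op (Fin d) :=
  Matrix.of fun a b => ∑ r : Fin (N + 1), X (a, r) (b, r)

/-- Partial trace over the clockwork. -/
def ptraceC {d N : ℕ} (X : Op (CR d N)) : Op (Fin (N + 1)) :=
  Matrix.of fun r s => ∑ a : Fin d, X (a, r) (a, s)

/-- `M^{t,k}_{C → CR}(X) = M^t_{CR → CR}(X ⊗ |k⟩⟨k|)`. -/
def fromTick {d N : ℕ} (M : ℝ → SuperOp (CR d N)) (t : ℝ) (k : Fin (N + 1))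
    (X : Op (Fin d)) : Op (CR d N) :=
  M t (X ⊗ₖ proj k)

/-- `tr_R [ M^{t,k}_{C → CR}(X) |n⟩⟨n| ]`. -/
def clockBlock {d N : ℕ} (M : ℝ → SuperOp (CR d N)) (t : ℝ) (k n : Fin (N + 1))
    (X : Op (Fin d)) : Op (Fin d) :=
  ptraceR (fromTick M t k X * ((1 : Op (Fin d)) ⊗ₖ proj n))

/-- The probability of finding the register in `|n⟩` at time `t`, from the input `ρ ⊗ |k⟩⟨k|`. -/
def tickProb {d N : ℕ} (M : ℝ → SuperOp (CR d N)) (ρ : Op (Fin d)) (k n : Fin (N + 1))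
    (t : ℝ) : ℝ :=
  (fromTick M t k ρ * ((1 : Op (Fin d)) ⊗ₖ proj n)).trace.re

/-- Condition 1, time invariance; the register labels `k + l` are taken modulo `N + 1`. -/
def TimeInvariance {d N : ℕ} (M : ℝ → SuperOp (CR d N)) : Prop :=
  ∀ t : ℝ, 0 ≤ t → ∀ ρ : Op (Fin d), IsState ρ → ∀ l k k' : Fin (N + 1),
    clockBlock M t k (k + l) ρ = clockBlock M t k' (k' + l) ρ

/-- Condition 2, self-timing. -/
def SelfTiming {d N : ℕ} (M : ℝ → SuperOp (CR d N)) : Prop :=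
  ∀ t₁ t₂ : ℝ, 0 ≤ t₁ → 0 ≤ t₂ → M (t₁ + t₂) = (M t₂).comp (M t₁)

/-- Condition 3, zeroth order. -/
def ZerothOrder {d N : ℕ} (M : ℝ → SuperOp (CR d N)) : Prop :=
  M 0 = ContinuousLinearMap.id ℂ (Op (CR d N)) ∧
    Tendsto (fun t : ℝ => ‖M t - ContinuousLinearMap.id ℂ (Op (CR d N))‖) (𝓝[>] 0) (𝓝 0)

/-- Condition 4, leading order: as `t → 0⁺`, the probability of reaching a register state other
than `k` and `k + 1` (modulo `N + 1`) is little-o of the probability of reaching `k + 1`. Unlike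
a quotient, this also makes sense where the latter probability vanishes. -/
def LeadingOrder {d N : ℕ} (M : ℝ → SuperOp (CR d N)) : Prop :=
  ∀ ρ : Op (Fin d), IsState ρ → ∀ k : Fin (N + 1),
    (fun t : ℝ => ∑ l ∈ Finset.univ.filter (fun l => l ≠ k ∧ l ≠ k + 1), tickProb M ρ k l t)
      =o[𝓝[>] 0] (fun t : ℝ => tickProb M ρ k (k + 1) t)

/-- Families of channels satisfying conditions 1 to 4. -/
structure IsPeriodicClockChannel {d N : ℕ} (M : ℝ → SuperOp (CR d N)) : Prop where
  isChannel : ∀ t : ℝ, 0 ≤ t → IsChannel (M t)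
  timeInvariance : TimeInvariance M
  selfTiming : SelfTiming M
  zerothOrder : ZerothOrder M
  leadingOrder : LeadingOrder M

/-- `P` is an underlying periodic-register clock channel of `M`: it satisfies conditions 1 to 4
and `M^{t,k}(ρ) = P^{t,k}(ρ) + o(t)` for `k = 0, …, N - 1`. -/
structure IsUnderlying {d N : ℕ} (P M : ℝ → SuperOp (CR d N)) : Prop where
  isPeriodicClockChannel : IsPeriodicClockChannel P
  agree : ∀ ρ : Op (Fin d), IsState ρ → ∀ k : Fin (N + 1), k ≠ Fin.last N →
    (fun t : ℝ => fromTick M t k ρ - fromTick P t k ρ) =o[𝓝[>] 0] (fun t : ℝ => t)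

/-- Condition 5, cut-off register. -/
def CutOff {d N : ℕ} (M : ℝ → SuperOp (CR d N)) : Prop :=
  (∃ P : ℝ → SuperOp (CR d N), IsUnderlying P M) ∧
    ∀ ρ : Op (Fin d), IsState ρ →
      (fun t : ℝ => ptraceC (fromTick M t (Fin.last N) ρ) - proj (Fin.last N))
        =o[𝓝[>] 0] (fun t : ℝ => t)

/-- Families of channels satisfying conditions 2 and 5. -/
structure IsCutOffClockChannel {d N : ℕ} (M : ℝ → SuperOp (CR d N)) : Prop where
  isChannel : ∀ t : ℝ, 0 ≤ t → IsChannel (M t)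
  selfTiming : SelfTiming M
  cutOff : CutOff M

/-- The two kinds of register. -/
inductive RegisterKind
  | periodic
  | cutOff

/-- A ticking clock: an initial state of clockwork and register, and a family of channels
satisfying conditions 1 to 4 (periodic register) or 2 and 5 (cut-off register). -/
def IsTickingClock {d N : ℕ} (κ : RegisterKind) (ρ₀ : Op (CR d N))
    (M : ℝ → SuperOp (CR d N)) : Prop :=
  IsState ρ₀ ∧
    match κ with
    | .periodic => IsPeriodicClockChannel M
    | .cutOff => IsCutOffClockChannel M

/-- Classical register: inputs `ρ ⊗ |k⟩⟨k|` evolve into `∑ n, σ n ⊗ |n⟩⟨n|` for subnormalised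
states `σ n` of the clockwork. -/
def HasClassicalRegister {d N : ℕ} (M : ℝ → SuperOp (CR d N)) : Prop :=
  ∀ t : ℝ, 0 ≤ t → ∀ ρ : Op (Fin d), IsState ρ → ∀ k : Fin (N + 1),
    ∃ σ : Fin (N + 1) → Op (Fin d), (∀ n, IsSubState (σ n)) ∧
      fromTick M t k ρ = ∑ n, σ n ⊗ₖ proj n

/-- Clockwork equivalence: there is a common underlying periodic-register clock channel. The
states of the clockwork from the register input `|N⟩⟨N|` may differ. -/
def ClockworkEquivalent {d N : ℕ} (M M' : ℝ → SuperOp (CR d N)) : Prop :=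
  ∃ P : ℝ → SuperOp (CR d N), IsUnderlying P M ∧ IsUnderlying P M'

/-- Equality of the dynamics of two clocks. Periodic register: the channels
`M^{t,k}_{C → CR}` are the same at all times. Cut-off register: the clocks are clockwork
equivalent and, at all times and from every register state `k`, the clockwork operators
conditioned on the register being in `n ≠ N` are the same, and so are the states of the
register; only the state of the clockwork conditioned on the register being full may differ. -/
def SameDynamics {d N : ℕ} (κ : RegisterKind) (M M' : ℝ → SuperOp (CR d N)) : Prop :=
  match κ with
  | .periodic => ∀ t : ℝ, 0 ≤ t → ∀ (k : Fin (N + 1)) (X : Op (Fin d)),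
      fromTick M t k X = fromTick M' t k X
  | .cutOff => ClockworkEquivalent M M' ∧
      ∀ t : ℝ, 0 ≤ t → ∀ (k : Fin (N + 1)) (X : Op (Fin d)),
        (∀ n : Fin (N + 1), n ≠ Fin.last N → clockBlock M t k n X = clockBlock M' t k n X) ∧
        ptraceC (fromTick M t k X) = ptraceC (fromTick M' t k X)

/-- The coefficient `l` of the wrap-around term in the tick operator. -/
def RegisterKind.wrap : RegisterKind → ℂ
  | .periodic => 1
  | .cutOff => 0

/-- `O = |1⟩⟨0| + |2⟩⟨1| + … + |N⟩⟨N-1| + l |0⟩⟨N|`. -/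
def shiftOp (N : ℕ) (κ : RegisterKind) : Op (Fin (N + 1)) :=
  ∑ k : Fin N, Matrix.single k.succ k.castSucc (1 : ℂ) +
    κ.wrap • Matrix.single (0 : Fin (N + 1)) (Fin.last N) (1 : ℂ)

/-- `X ↦ -i [H, X]`. -/
def hamiltonianPart {ι : Type} [Fintype ι] [DecidableEq ι] (H : Op ι) : Op ι →ₗ[ℂ] Op ι :=
  (-Complex.I) • (LinearMap.mulLeft ℂ H - LinearMap.mulRight ℂ H)

/-- `X ↦ V X V† - ½ {V† V, X}`. -/
def dissipator {ι : Type} [Fintype ι] [DecidableEq ι] (V : Op ι) : Op ι →ₗ[ℂ] Op ι :=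
  (LinearMap.mulLeft ℂ V).comp (LinearMap.mulRight ℂ Vᴴ) -
    (1 / 2 : ℂ) • (LinearMap.mulLeft ℂ (Vᴴ * V) + LinearMap.mulRight ℂ (Vᴴ * V))

/-- The generator with Hamiltonian `H ⊗ 1`, jump operators `L j ⊗ 1` and tick operators
`J j ⊗ O`. -/
def generator {d N m : ℕ} (κ : RegisterKind) (H : Op (Fin d)) (L J : Fin m → Op (Fin d)) :
    SuperOp (CR d N) :=
  LinearMap.toContinuousLinearMap
    (hamiltonianPart (H ⊗ₖ (1 : Op (Fin (N + 1)))) +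
      ∑ j, dissipator (L j ⊗ₖ (1 : Op (Fin (N + 1)))) +
      ∑ j, dissipator (J j ⊗ₖ shiftOp N κ))

/-- The semigroup `t ↦ exp (t 𝓛)`. -/
def lindbladSemigroup {d N m : ℕ} (κ : RegisterKind) (H : Op (Fin d))
    (L J : Fin m → Op (Fin d)) (t : ℝ) : SuperOp (CR d N) :=
  NormedSpace.exp ((t : ℂ) • (generator κ H L J : SuperOp (CR d N)))

end

end TickingClock

/-!
The register-diagonal blocks of a clock channel carry all the information that enters the statement,
so everything is expressed through the inputs `emb k X = X ⊗ |k⟩⟨k|` and the blocks `blk n n`.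

A generator `𝓛` of tick type maps `emb k X` to `emb k (A X) + emb (k + 1) (∑ J X J†)` with a weight
on the ticks that vanishes only for the last state of a cut-off register (`generator_emb`). Hence
`exp (t 𝓛)` preserves block-diagonal operators and commutes with translations of a periodic
register. It consists of channels because it is the limit of powers of completely positive Euler
steps (`isChannel_exp_lindbladian`). For the leading-order condition, the weight `p` of `k + 1` and
the weight `S` of the states other than `k`, `k + 1` satisfy `p' ≥ -C p` and `S' ≤ C p`, which gives
`S t ≤ C t e^{C t} p t` whether or not `p` is of first order
(`leadingOrder_lindbladSemigroup`). For a cut-off register, the semigroup with the wrap-around tick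
restored is an underlying periodic clock.

Conversely, a periodic clock channel is a norm-continuous semigroup, hence `exp (t G)`
(`exists_generator`). By time invariance and the leading-order condition, the diagonal blocks of
`G (emb k X)` are a map `Γ₀ X` at `k`, a map `Γ₁ X` at `k + 1`, and zero elsewhere. The map `Γ₁` is
completely positive, which provides the `J`. The map `Γ₀` is the derivative at the identity of
completely positive maps, so `Γ₀ X = K X + X K† + ∑ L X L†` (`exists_form_of_tendsto`), and trace
preservation fixes the Hermitian part of `K`
(`IsPeriodicClockChannel.exists_lindblad_form`). If the register is classical, `G (emb k X)` has no
further blocks.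

For a cut-off register only the underlying periodic clock is known to be a continuous semigroup, and
its register need not be classical; but the clock itself has the same first-order expansion on
`emb k X` for `k ≠ N`, and is classical. The weight that leaves the state `N` is subadditive in time
up to a constant and `o(t)`, hence zero, so `N` is absorbing
(`IsCutOffClockChannel.blk_last_eq_zero`). Therefore the compression to the register states `n ≠ N`
is again a semigroup, it is norm continuous, and it is determined by its first-order expansion
(`IsCutOffClockChannel.blk_eq`).
-/

namespace TickingClock

/-! ### Exponentials and semigroups in a Banach algebra -/

section BanachAlgebra

variable {𝔸 : Type*} [NormedRing 𝔸]

theorem norm_pow_sub_pow_le [NormOneClass 𝔸] {A B : 𝔸} {r : ℝ} (hA : ‖A‖ ≤ r) (hB : ‖B‖ ≤ r)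
    (hr : 1 ≤ r) (n : ℕ) : ‖A ^ n - B ^ n‖ ≤ n * r ^ n * ‖A - B‖ := by
  have hr0 : 0 ≤ r := zero_le_one.trans hr
  induction n with
  | zero => simp
  | succ n ih =>
    have hBn : ‖B ^ n‖ ≤ r ^ (n + 1) :=
      (norm_pow_le B n).trans ((pow_le_pow_left₀ (norm_nonneg _) hB n).trans
        (pow_le_pow_right₀ hr n.le_succ))
    calc ‖A ^ (n + 1) - B ^ (n + 1)‖ = ‖A * (A ^ n - B ^ n) + (A - B) * B ^ n‖ := by
          congr 1; rw [pow_succ' A, pow_succ' B]; noncomm_ring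
      _ ≤ ‖A‖ * ‖A ^ n - B ^ n‖ + ‖A - B‖ * ‖B ^ n‖ :=
          (norm_add_le _ _).trans (add_le_add (norm_mul_le _ _) (norm_mul_le _ _))
      _ ≤ r * (n * r ^ n * ‖A - B‖) + ‖A - B‖ * r ^ (n + 1) := by gcongr
      _ = (n + 1 : ℕ) * r ^ (n + 1) * ‖A - B‖ := by push_cast; ring

/-- A one-parameter semigroup that is norm continuous at `0` takes the value `1` at `0`: it is
idempotent there, and invertible nearby. -/
theorem semigroup_zero {T : ℝ → 𝔸} (hadd : ∀ s t, 0 ≤ s → 0 ≤ t → T (s + t) = T s * T t)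
    (hlim : Tendsto T (𝓝[>] 0) (𝓝 1)) : T 0 = 1 := by
  have h1 : Tendsto (fun t => T 0 * T t) (𝓝[>] 0) (𝓝 (T 0)) := by
    simpa using hlim.const_mul (T 0)
  have h2 : (fun t => T 0 * T t) =ᶠ[𝓝[>] 0] T := by
    filter_upwards [self_mem_nhdsWithin] with t (ht : 0 < t)
    rw [← hadd 0 t le_rfl ht.le, zero_add]
  exact tendsto_nhds_unique (h1.congr' h2) hlim

/-- A one-parameter semigroup that is norm continuous at `0` is continuous on `[0, ∞)`. -/
theorem semigroup_continuous {T : ℝ → 𝔸} (hadd : ∀ s t, 0 ≤ s → 0 ≤ t → T (s + t) = T s * T t)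
    (hlim : Tendsto T (𝓝[>] 0) (𝓝 1)) : Continuous fun t => T (max t 0) := by
  have h0 := semigroup_zero hadd hlim
  have hlim' : Tendsto T (𝓝[≥] 0) (𝓝 1) := by
    rw [← Set.Ioi_insert, nhdsWithin_insert, tendsto_sup]
    exact ⟨by simpa [h0] using tendsto_pure_nhds T 0, hlim⟩
  -- local boundedness, from boundedness near `0` and the semigroup law
  have hbdd : ∀ R : ℝ, ∃ C, ∀ t, 0 ≤ t → t ≤ R → ‖T t‖ ≤ C := by
    intro R
    have hK := hlim'.norm.eventually (gt_mem_nhds (lt_add_one ‖(1 : 𝔸)‖))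
    rw [eventually_nhdsWithin_iff, Metric.eventually_nhds_iff] at hK
    obtain ⟨δ, hδ, hK⟩ := hK
    obtain ⟨n, hn⟩ := exists_nat_gt (R / δ)
    have hpow : ∀ (m : ℕ) (t : ℝ), 0 ≤ t → T ((m + 1 : ℕ) * t) = T t ^ (m + 1) := by
      intro m t ht
      induction m with
      | zero => simp
      | succ m ih =>
        rw [pow_succ, ← ih, ← hadd _ _ (by positivity) ht]
        congr 1; push_cast; ring
    refine ⟨(‖(1 : 𝔸)‖ + 1) ^ (n + 1), fun t ht htR => ?_⟩
    have hn0 : (0 : ℝ) < (n + 1 : ℕ) := by positivity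
    have ht' : 0 ≤ t / (n + 1 : ℕ) := by positivity
    have hlt : t / (n + 1 : ℕ) < δ := by
      rw [div_lt_iff₀ hn0]
      have := (div_lt_iff₀ hδ).1 hn
      push_cast
      nlinarith
    have := hpow n _ ht'
    rw [mul_div_cancel₀ _ hn0.ne'] at this
    rw [this]
    refine (norm_pow_le' _ n.succ_pos).trans (pow_le_pow_left₀ (norm_nonneg _) (le_of_lt ?_) _)
    exact hK (by rwa [Real.dist_eq, sub_zero, abs_of_nonneg ht']) ht'
  rw [continuous_iff_continuousAt]
  intro t₀
  obtain ⟨C, hC⟩ := hbdd (max t₀ 0 + 1)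
  have hC0 : 0 ≤ C := (norm_nonneg _).trans (hC 0 le_rfl (by positivity))
  have key : ∀ a b : ℝ, 0 ≤ a → 0 ≤ b → a ≤ max t₀ 0 + 1 → b ≤ max t₀ 0 + 1 →
      ‖T a - T b‖ ≤ C * ‖T |a - b| - 1‖ := by
    intro a b ha hb haR hbR
    wlog hab : a ≤ b generalizing a b
    · rw [norm_sub_rev, abs_sub_comm]
      exact this b a hb ha hbR haR (le_of_not_ge hab)
    rw [abs_sub_comm, abs_of_nonneg (sub_nonneg.2 hab), norm_sub_rev]
    have : T b - T a = T a * (T (b - a) - 1) := by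
      rw [mul_sub, mul_one, ← hadd a (b - a) ha (sub_nonneg.2 hab), add_sub_cancel]
    rw [this]
    exact (norm_mul_le _ _).trans (by gcongr; exact hC a ha haR)
  have hd : Tendsto (fun t : ℝ => |max t 0 - max t₀ 0|) (𝓝 t₀) (𝓝[≥] 0) := by
    refine tendsto_nhdsWithin_iff.2 ⟨?_, Eventually.of_forall fun t => Set.mem_Ici.2 (abs_nonneg _)⟩
    have : Continuous fun t : ℝ => |max t 0 - max t₀ 0| := by fun_prop
    simpa using this.tendsto t₀
  rw [ContinuousAt, tendsto_iff_norm_sub_tendsto_zero]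
  have hz : Tendsto (fun t : ℝ => C * ‖T |max t 0 - max t₀ 0| - 1‖) (𝓝 t₀) (𝓝 0) := by
    simpa using ((hlim'.comp hd).sub_const 1).norm.const_mul C
  refine squeeze_zero' (Eventually.of_forall fun _ => norm_nonneg _) ?_ hz
  filter_upwards [gt_mem_nhds (lt_add_one t₀)] with t ht
  refine key _ _ (le_max_right _ _) (le_max_right _ _) ?_ (by linarith)
  refine max_le ?_ (by positivity)
  linarith [le_max_left t₀ 0]

variable [NormedAlgebra ℝ 𝔸]

theorem exp_zero_smul (G : 𝔸) : NormedSpace.exp ((0 : ℝ) • G) = 1 := by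
  rw [zero_smul, NormedSpace.exp_zero]

variable [CompleteSpace 𝔸]

theorem hasDerivAt_exp_smul (G : 𝔸) (t : ℝ) :
    HasDerivAt (fun s : ℝ => NormedSpace.exp (s • G)) (NormedSpace.exp (t • G) * G) t :=
  hasDerivAt_exp_smul_const G t

theorem exp_add_smul (G : 𝔸) (s t : ℝ) :
    NormedSpace.exp ((s + t) • G) = NormedSpace.exp (s • G) * NormedSpace.exp (t • G) := by
  let _ : NormedAlgebra ℚ 𝔸 := NormedAlgebra.restrictScalars ℚ ℝ 𝔸
  rw [add_smul, NormedSpace.exp_add_of_commute]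
  exact ((Commute.refl G).smul_left s).smul_right t

theorem exp_smul_isLittleO (G : 𝔸) :
    (fun s : ℝ => NormedSpace.exp (s • G) - 1 - s • G) =o[𝓝 0] (fun s : ℝ => s) := by
  have h := (hasDerivAt_exp_smul G 0).isLittleO
  simpa using h

theorem norm_exp_le_exp_norm [NormOneClass 𝔸] (x : 𝔸) :
    ‖NormedSpace.exp x‖ ≤ Real.exp ‖x‖ := by
  have h1 := NormedSpace.exp_series_hasSum_exp' (𝕂 := ℝ) x
  have h2 := NormedSpace.exp_series_hasSum_exp' (𝕂 := ℝ) ‖x‖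
  rw [← Real.exp_eq_exp_ℝ] at h2
  refine h1.norm_le_of_bounded h2 fun n => ?_
  rw [norm_smul, smul_eq_mul, Real.norm_of_nonneg (by positivity)]
  gcongr
  exact norm_pow_le _ _

/-- Euler's product formula, with a perturbation of second order in the step. -/
theorem tendsto_euler_pow_exp [NormOneClass 𝔸] (x q : 𝔸) :
    Tendsto (fun n : ℕ => (1 + (n : ℝ)⁻¹ • x + ((n : ℝ)⁻¹ ^ 2) • q) ^ n) atTop
      (𝓝 (NormedSpace.exp x)) := by
  set c : ℝ := ‖x‖ + ‖q‖
  have hinv : Tendsto (fun n : ℕ => (n : ℝ)⁻¹) atTop (𝓝 0) := tendsto_inv_atTop_nhds_zero_nat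
  have ho : (fun n : ℕ => 1 + (n : ℝ)⁻¹ • x + ((n : ℝ)⁻¹ ^ 2) • q
      - NormedSpace.exp ((n : ℝ)⁻¹ • x)) =o[atTop] (fun n : ℕ => (n : ℝ)⁻¹) := by
    have h1 := (exp_smul_isLittleO x).comp_tendsto hinv
    have h2 : (fun s : ℝ => s ^ 2 • q) =o[𝓝 0] (fun s : ℝ => s) := by
      have : (fun s : ℝ => s ^ 2 • q) =O[𝓝 0] (fun s : ℝ => s ^ 2) :=
        IsBigO.of_bound ‖q‖ (Eventually.of_forall fun s => by rw [norm_smul, mul_comm])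
      refine this.trans_isLittleO ?_
      simpa using isLittleO_pow_id (𝕜 := ℝ) one_lt_two
    refine ((h2.comp_tendsto hinv).sub h1).congr_left fun n => ?_
    simp only [Function.comp_apply]
    abel
  rw [tendsto_iff_norm_sub_tendsto_zero]
  have hz : Tendsto (fun n : ℕ => Real.exp c * (‖1 + (n : ℝ)⁻¹ • x + ((n : ℝ)⁻¹ ^ 2) • q
      - NormedSpace.exp ((n : ℝ)⁻¹ • x)‖ / (n : ℝ)⁻¹)) atTop (𝓝 0) := by
    simpa using (ho.norm_left.tendsto_div_nhds_zero).const_mul (Real.exp c)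
  refine squeeze_zero' (Eventually.of_forall fun _ => norm_nonneg _) ?_ hz
  filter_upwards [eventually_ge_atTop 1] with n hn
  have hn0 : (0 : ℝ) < n := by exact_mod_cast hn
  have hn1 : (n : ℝ)⁻¹ ≤ 1 := inv_le_one_of_one_le₀ (by exact_mod_cast hn)
  have hE : NormedSpace.exp x = NormedSpace.exp ((n : ℝ)⁻¹ • x) ^ n := by
    let _ : NormedAlgebra ℚ 𝔸 := NormedAlgebra.restrictScalars ℚ ℝ 𝔸
    rw [← NormedSpace.exp_nsmul, ← Nat.cast_smul_eq_nsmul ℝ, smul_smul,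
      mul_inv_cancel₀ hn0.ne', one_smul]
  have hr : (1 : ℝ) ≤ Real.exp ((n : ℝ)⁻¹ * c) := Real.one_le_exp (by positivity)
  have hA : ‖1 + (n : ℝ)⁻¹ • x + ((n : ℝ)⁻¹ ^ 2) • q‖ ≤ Real.exp ((n : ℝ)⁻¹ * c) := by
    calc _ ≤ ‖(1 : 𝔸)‖ + ‖(n : ℝ)⁻¹ • x‖ + ‖((n : ℝ)⁻¹ ^ 2) • q‖ := norm_add₃_le
      _ = 1 + (n : ℝ)⁻¹ * ‖x‖ + (n : ℝ)⁻¹ ^ 2 * ‖q‖ := by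
          rw [norm_one, norm_smul, norm_smul, Real.norm_of_nonneg (by positivity),
            Real.norm_of_nonneg (by positivity)]
      _ ≤ 1 + (n : ℝ)⁻¹ * ‖x‖ + (n : ℝ)⁻¹ * ‖q‖ := by
          have : (n : ℝ)⁻¹ ^ 2 ≤ (n : ℝ)⁻¹ := by
            rw [sq]; exact mul_le_of_le_one_left (by positivity) hn1
          gcongr
      _ = (n : ℝ)⁻¹ * c + 1 := by ring
      _ ≤ _ := Real.add_one_le_exp _
  have hB : ‖NormedSpace.exp ((n : ℝ)⁻¹ • x)‖ ≤ Real.exp ((n : ℝ)⁻¹ * c) := by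
    refine (norm_exp_le_exp_norm _).trans (Real.exp_le_exp.2 ?_)
    rw [norm_smul, Real.norm_of_nonneg (by positivity)]
    gcongr
    exact le_add_of_nonneg_right (norm_nonneg _)
  rw [hE]
  refine (norm_pow_sub_pow_le hA hB hr n).trans (le_of_eq ?_)
  rw [← Real.exp_nat_mul, ← mul_assoc, mul_inv_cancel₀ hn0.ne', one_mul, div_inv_eq_mul]
  ring

/-- A one-parameter semigroup that is norm continuous at `0` is the exponential of a generator.
The integral `V` of `T` over a short interval is invertible, and `T t * V` is differentiable in
`t`. -/
theorem exists_generator {T : ℝ → 𝔸} (hadd : ∀ s t, 0 ≤ s → 0 ≤ t → T (s + t) = T s * T t)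
    (hlim : Tendsto T (𝓝[>] 0) (𝓝 1)) :
    ∃ G : 𝔸, ∀ t, 0 ≤ t → T t = NormedSpace.exp (t • G) := by
  have h0 := semigroup_zero hadd hlim
  have hcont := semigroup_continuous hadd hlim
  set S : ℝ → 𝔸 := fun t => T (max t 0) with hS
  have hST : ∀ t, 0 ≤ t → S t = T t := fun t ht => by simp [hS, max_eq_left ht]
  have hint : ∀ a b, IntervalIntegrable S MeasureTheory.volume a b :=
    fun a b => hcont.intervalIntegrable a b
  set Φ : ℝ → 𝔸 := fun t => ∫ s in (0 : ℝ)..t, S s with hΦ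
  have hΦ' : ∀ t, HasDerivAt Φ (S t) t := fun t =>
    intervalIntegral.integral_hasDerivAt_right (hint 0 t)
      (hcont.stronglyMeasurableAtFilter _ _) hcont.continuousAt
  -- the mean of `T` over a short interval is close to `1`, hence invertible
  obtain ⟨δ, hδ, hunit⟩ : ∃ δ : ℝ, 0 < δ ∧ IsUnit (δ⁻¹ • Φ δ) := by
    have h := (hΦ' 0).tendsto_slope_zero_right
    have hS0 : S 0 = 1 := by rw [hST 0 le_rfl, h0]
    have hΦ0 : Φ 0 = 0 := by simp [hΦ]
    simp only [zero_add, hS0, hΦ0, sub_zero] at h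
    have hopen : ∀ᶠ y : 𝔸 in 𝓝 1, IsUnit y := Units.isOpen.mem_nhds isUnit_one
    obtain ⟨δ, h1, h2⟩ := ((h.eventually hopen).and self_mem_nhdsWithin).exists
    exact ⟨δ, h2, h1⟩
  have hV : IsUnit (Φ δ) := by
    have := hunit.smul (Units.mk0 δ hδ.ne')
    rwa [Units.smul_def, Units.val_mk0, smul_smul, mul_inv_cancel₀ hδ.ne', one_smul] at this
  obtain ⟨V, hV⟩ := hV
  have hTV : ∀ t, 0 ≤ t → T t * V = Φ (t + δ) - Φ t := by
    intro t ht
    have h1 : Φ (t + δ) - Φ t = ∫ s in t..(t + δ), S s :=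
      intervalIntegral.integral_interval_sub_left (hint _ _) (hint _ _)
    have h2 : ∫ s in t..(t + δ), S s = ∫ s in (0 : ℝ)..δ, S (t + s) := by
      rw [intervalIntegral.integral_comp_add_left (fun s => S s) t, add_zero]
    rw [h1, h2, hV, hΦ]
    simp only
    rw [← ContinuousLinearMap.mul_apply' ℝ 𝔸 (T t),
      ← ContinuousLinearMap.intervalIntegral_comp_comm _ (hint 0 δ)]
    refine intervalIntegral.integral_congr fun s hs => ?_
    rw [Set.uIcc_of_le hδ.le] at hs
    simp only [ContinuousLinearMap.mul_apply']
    rw [hST s hs.1, hST _ (add_nonneg ht hs.1), hadd t s ht hs.1]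
  set G : 𝔸 := (T δ - 1) * ↑V⁻¹ with hG
  refine ⟨G, fun t ht => ?_⟩
  set F : ℝ → 𝔸 := fun t => (Φ (t + δ) - Φ t) * ↑V⁻¹ with hF
  have hFT : ∀ t, 0 ≤ t → F t = T t := fun t ht => by
    rw [hF]; simp only; rw [← hTV t ht, mul_assoc, V.mul_inv, mul_one]
  have hF' : ∀ t, 0 ≤ t → HasDerivAt F (T t * G) t := by
    intro t ht
    have h1 : HasDerivAt (fun t => Φ (t + δ)) (S (t + δ)) t := (hΦ' (t + δ)).comp_add_const t δ
    have h2 := (h1.sub (hΦ' t)).mul_const (↑V⁻¹ : 𝔸)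
    rw [hST _ (by positivity), hST t ht, hadd t δ ht hδ.le] at h2
    have h3 : (T t * T δ - T t) * (↑V⁻¹ : 𝔸) = T t * G := by rw [hG]; noncomm_ring
    rwa [h3] at h2
  have hY : ∀ s ∈ Set.Icc (0 : ℝ) t, F s * NormedSpace.exp ((-s) • G)
      = F 0 * NormedSpace.exp ((-(0 : ℝ)) • G) := by
    have hd : ∀ s, 0 ≤ s → HasDerivAt (fun s => F s * NormedSpace.exp ((-s) • G)) 0 s := by
      intro s hs
      have he : HasDerivAt (fun s : ℝ => NormedSpace.exp ((-s) • G))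
          (-(G * NormedSpace.exp ((-s) • G))) s := by
        have h1 : HasDerivAt (fun u : ℝ => NormedSpace.exp (u • G))
          (G * NormedSpace.exp ((-s) • G)) (-s) := hasDerivAt_exp_smul_const' G (-s)
        have h2 := h1.scomp s (hasDerivAt_neg s)
        rw [neg_one_smul] at h2
        exact h2
      have h1 := (hF' s hs).mul he
      have h2 : T s * G * NormedSpace.exp ((-s) • G)
          + F s * -(G * NormedSpace.exp ((-s) • G)) = 0 := by
        rw [hFT s hs]; noncomm_ring
      rwa [h2] at h1
    refine constant_of_has_deriv_right_zero
      (fun s hs => (hd s hs.1).continuousAt.continuousWithinAt)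
      (fun s hs => (hd s hs.1).hasDerivWithinAt)
  have h1 := hY t ⟨ht, le_rfl⟩
  rw [hFT t ht, hFT 0 le_rfl, h0] at h1
  have h2 : NormedSpace.exp ((-t) • G) * NormedSpace.exp (t • G) = 1 := by
    rw [← exp_add_smul, neg_add_cancel, zero_smul, NormedSpace.exp_zero]
  calc T t = T t * (NormedSpace.exp ((-t) • G) * NormedSpace.exp (t • G)) := by rw [h2, mul_one]
    _ = NormedSpace.exp (t • G) := by
      rw [← mul_assoc, h1, neg_zero, zero_smul, NormedSpace.exp_zero, one_mul, one_mul]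

/-- Norm-continuous semigroups that agree to first order at `0` are equal. -/
theorem semigroup_eq_of_isLittleO {T T' : ℝ → 𝔸}
    (hadd : ∀ s t, 0 ≤ s → 0 ≤ t → T (s + t) = T s * T t) (hlim : Tendsto T (𝓝[>] 0) (𝓝 1))
    (hadd' : ∀ s t, 0 ≤ s → 0 ≤ t → T' (s + t) = T' s * T' t)
    (hlim' : Tendsto T' (𝓝[>] 0) (𝓝 1))
    (ho : (fun t => T t - T' t) =o[𝓝[>] 0] (fun t : ℝ => t)) {t : ℝ} (ht : 0 ≤ t) :
    T t = T' t := by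
  obtain ⟨G, hG⟩ := exists_generator hadd hlim
  obtain ⟨G', hG'⟩ := exists_generator hadd' hlim'
  have h1 := (exp_smul_isLittleO G).mono (nhdsWithin_le_nhds (s := Set.Ioi (0 : ℝ)))
  have h2 := (exp_smul_isLittleO G').mono (nhdsWithin_le_nhds (s := Set.Ioi (0 : ℝ)))
  have h3 : (fun s : ℝ => s • (G - G')) =o[𝓝[>] 0] (fun s : ℝ => s) := by
    refine ((h2.sub h1).add ho).congr' ?_ EventuallyEq.rfl
    filter_upwards [self_mem_nhdsWithin] with s (hs : 0 < s)
    rw [hG s hs.le, hG' s hs.le, smul_sub]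
    abel
  have h4 : Tendsto (fun _ : ℝ => ‖G - G'‖) (𝓝[>] 0) (𝓝 0) := by
    refine (h3.norm_left.norm_right.tendsto_div_nhds_zero).congr' ?_
    filter_upwards [self_mem_nhdsWithin] with s (hs : 0 < s)
    rw [norm_smul, mul_div_cancel_left₀ _ (norm_ne_zero_iff.2 hs.ne')]
  have h5 : G = G' := sub_eq_zero.1 (norm_eq_zero.1 (tendsto_nhds_unique tendsto_const_nhds h4))
  rw [hG t ht, hG' t ht, h5]

end BanachAlgebra

section Intertwining

variable {E F : Type*} [NormedAddCommGroup E] [NormedSpace ℂ E] [CompleteSpace E]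
  [NormedAddCommGroup F] [NormedSpace ℂ F] [CompleteSpace F]

theorem hasSum_exp_apply (G : E →L[ℂ] E) (x : E) :
    HasSum (fun n : ℕ => ((n.factorial : ℂ)⁻¹) • (G ^ n) x) (NormedSpace.exp G x) := by
  have h := NormedSpace.exp_series_hasSum_exp' (𝕂 := ℂ) G
  exact h.mapL (ContinuousLinearMap.apply ℂ E x)

theorem exp_apply_mem {p : Submodule ℂ E} (hp : IsClosed (p : Set E)) {G : E →L[ℂ] E}
    (hG : ∀ x ∈ p, G x ∈ p) {x : E} (hx : x ∈ p) : NormedSpace.exp G x ∈ p := by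
  have hn : ∀ n : ℕ, (G ^ n) x ∈ p := by
    intro n
    induction n with
    | zero => simpa using hx
    | succ n ih => rw [pow_succ']; exact hG _ ih
  refine hp.mem_of_tendsto (hasSum_exp_apply G x) (Eventually.of_forall fun s => ?_)
  exact p.sum_mem fun n _ => p.smul_mem _ (hn n)

/-- A map that intertwines two generators on an invariant subspace intertwines the exponentials
there. -/
theorem exp_intertwine {p : Submodule ℂ E} {G : E →L[ℂ] E} {G' : F →L[ℂ] F} (S : E →L[ℂ] F)
    (hG : ∀ x ∈ p, G x ∈ p) (hS : ∀ x ∈ p, S (G x) = G' (S x)) {x : E} (hx : x ∈ p) :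
    S (NormedSpace.exp G x) = NormedSpace.exp G' (S x) := by
  have hn : ∀ n : ℕ, (G ^ n) x ∈ p ∧ S ((G ^ n) x) = (G' ^ n) (S x) := by
    intro n
    induction n with
    | zero => simpa using hx
    | succ n ih =>
      rw [pow_succ', pow_succ']
      refine ⟨hG _ ih.1, ?_⟩
      simp only [mul_apply_eq_comp]
      rw [hS _ ih.1, ih.2]
  refine ((hasSum_exp_apply G x).mapL S).unique ?_
  refine (hasSum_exp_apply G' (S x)).congr_fun fun n => ?_
  rw [map_smul, (hn n).2]

theorem exp_smul_apply_mem {p : Submodule ℂ E} (hp : IsClosed (p : Set E)) {G : E →L[ℂ] E}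
    (hG : ∀ x ∈ p, G x ∈ p) (t : ℝ) {x : E} (hx : x ∈ p) : NormedSpace.exp (t • G) x ∈ p :=
  exp_apply_mem hp (fun y hy => p.smul_of_tower_mem t (hG y hy)) hx

theorem exp_smul_intertwine {p : Submodule ℂ E} {G : E →L[ℂ] E} {G' : F →L[ℂ] F} (S : E →L[ℂ] F)
    (hG : ∀ x ∈ p, G x ∈ p) (hS : ∀ x ∈ p, S (G x) = G' (S x)) (t : ℝ) {x : E} (hx : x ∈ p) :
    S (NormedSpace.exp (t • G) x) = NormedSpace.exp (t • G') (S x) :=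
  exp_intertwine S (fun y hy => p.smul_of_tower_mem t (hG y hy))
    (fun y hy => by
      rw [_root_.smul_apply, _root_.smul_apply, S.map_smul_of_tower, hS y hy]) hx

end Intertwining

/-! ### Positive semidefinite matrices -/

section PosSemidef

variable {ι : Type} [Fintype ι]

theorem posSemidef_re_trace_nonneg {A : Op ι} (hA : A.PosSemidef) : 0 ≤ A.trace.re :=
  (Complex.le_def.1 hA.trace_nonneg).1

theorem posSemidef_trace_eq_re {A : Op ι} (hA : A.PosSemidef) : A.trace = (A.trace.re : ℂ) :=
  Complex.ext rfl (by simpa using (Complex.le_def.1 hA.trace_nonneg).2.symm)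

theorem posSemidef_eq_zero_of_re_trace {A : Op ι} (hA : A.PosSemidef) (h : A.trace.re = 0) :
    A = 0 :=
  hA.trace_eq_zero_iff.1 (by rw [posSemidef_trace_eq_re hA, h, Complex.ofReal_zero])

theorem posSemidef_of_tendsto {α : Type*} {l : Filter α} [l.NeBot] {f : α → Op ι} {A : Op ι}
    (h : Tendsto f l (𝓝 A)) (hf : ∀ᶠ t in l, (f t).PosSemidef) : A.PosSemidef := by
  refine PosSemidef.of_dotProduct_mulVec_nonneg ?_ fun x => ?_
  · have h1 : Tendsto (fun t => (f t)ᴴ) l (𝓝 Aᴴ) :=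
      (continuous_id.matrix_conjTranspose.tendsto A).comp h
    refine tendsto_nhds_unique (h1.congr' ?_) h
    filter_upwards [hf] with t ht using ht.isHermitian
  · have hc : Continuous fun B : Op ι => star x ⬝ᵥ (B *ᵥ x) :=
      continuous_const.dotProduct (continuous_id.matrix_mulVec continuous_const)
    refine ge_of_tendsto ((hc.tendsto A).comp h) ?_
    filter_upwards [hf] with t ht using ht.dotProduct_mulVec_nonneg x

theorem posSemidef_norm_apply_le {A : Op ι} (hA : A.PosSemidef) (i j : ι) :
    ‖A i j‖ ≤ A.trace.re := by
  have hdiag : ∀ i, A i i = ((A i i).re : ℂ) ∧ 0 ≤ (A i i).re := fun i => by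
    have h := Complex.le_def.1 (hA.diag_nonneg (i := i))
    exact ⟨Complex.ext rfl (by simpa using h.2.symm), h.1⟩
  have hle : ∀ i, (A i i).re ≤ A.trace.re := fun i => by
    rw [Matrix.trace, Complex.re_sum]
    exact Finset.single_le_sum (f := fun i => (A i i).re) (fun k _ => (hdiag k).2)
      (Finset.mem_univ i)
  -- the principal minor on `i, j` is nonnegative
  have hdet := (hA.submatrix ![i, j]).det_nonneg
  rw [Matrix.det_fin_two] at hdet
  simp only [submatrix_apply, cons_val_zero, cons_val_one] at hdet
  have hji : A j i = star (A i j) := (hA.isHermitian.apply j i).symm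
  rw [hji, (hdiag i).1, (hdiag j).1, Complex.star_def, Complex.mul_conj, Complex.normSq_eq_norm_sq,
    ← Complex.ofReal_mul, ← Complex.ofReal_sub] at hdet
  have h2 : ‖A i j‖ ^ 2 ≤ (A i i).re * (A j j).re := by
    have := (Complex.le_def.1 hdet).1
    simp only [Complex.zero_re, Complex.ofReal_re] at this
    linarith
  refine (sq_le_sq₀ (norm_nonneg _) (posSemidef_re_trace_nonneg hA)).1 ?_
  calc _ ≤ _ := h2
    _ ≤ A.trace.re * A.trace.re :=
      mul_le_mul (hle i) (hle j) (hdiag j).2 (posSemidef_re_trace_nonneg hA)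
    _ = _ := (sq _).symm

variable [DecidableEq ι]

/-- The norm is controlled by the trace on positive semidefinite operators. -/
theorem exists_norm_le_mul_trace :
    ∃ C : ℝ, 0 ≤ C ∧ ∀ A : Op ι, A.PosSemidef → ‖A‖ ≤ C * A.trace.re := by
  refine ⟨∑ i : ι, ∑ j : ι, ‖Matrix.single i j (1 : ℂ)‖, by positivity, fun A hA => ?_⟩
  conv_lhs => rw [Matrix.matrix_eq_sum_single A]
  refine (norm_sum_le _ _).trans ?_
  rw [Finset.sum_mul]
  refine Finset.sum_le_sum fun i _ => (norm_sum_le _ _).trans ?_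
  rw [Finset.sum_mul]
  refine Finset.sum_le_sum fun j _ => ?_
  have : Matrix.single i j (A i j) = A i j • Matrix.single i j (1 : ℂ) := by
    rw [Matrix.smul_single, smul_eq_mul, mul_one]
  rw [this, norm_smul, mul_comm]
  gcongr
  exact posSemidef_norm_apply_le hA i j

open scoped MatrixOrder in
theorem posSemidef_exists_eq {A : Op ι} (hA : A.PosSemidef) : ∃ B : Op ι, A = Bᴴ * B := by
  obtain ⟨B, hB⟩ := CStarAlgebra.nonneg_iff_eq_star_mul_self.1 (nonneg_iff_posSemidef.2 hA)
  exact ⟨B, hB⟩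

open scoped MatrixOrder in
/-- The states span the operators. -/
theorem eq_top_of_states_mem {p : Submodule ℂ (Op ι)} (h : ∀ ρ, IsState ρ → ρ ∈ p) : p = ⊤ := by
  rw [eq_top_iff, ← CStarAlgebra.span_nonneg (A := Op ι), Submodule.span_le]
  intro A hA
  have hA : A.PosSemidef := nonneg_iff_posSemidef.1 hA
  by_cases h0 : A.trace.re = 0
  · rw [posSemidef_eq_zero_of_re_trace hA h0]; exact p.zero_mem
  · have h1 : (A.trace.re : ℂ) ≠ 0 := by exact_mod_cast h0
    have hs : IsState ((A.trace.re : ℂ)⁻¹ • A) := by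
      refine ⟨hA.smul ?_, ?_⟩
      · rw [← Complex.ofReal_inv]
        exact_mod_cast inv_nonneg.2 (posSemidef_re_trace_nonneg hA)
      · rw [trace_smul, posSemidef_trace_eq_re hA, smul_eq_mul, Complex.ofReal_re,
          inv_mul_cancel₀ h1]
    have := p.smul_mem (A.trace.re : ℂ) (h _ hs)
    rwa [smul_smul, mul_inv_cancel₀ h1, one_smul] at this

theorem linearMap_eq_of_states {E : Type*} [AddCommGroup E] [Module ℂ E] {f g : Op ι →ₗ[ℂ] E}
    (h : ∀ ρ, IsState ρ → f ρ = g ρ) (X : Op ι) : f X = g X := by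
  have : LinearMap.eqLocus f g = ⊤ := eq_top_of_states_mem h
  exact (this ▸ Submodule.mem_top : X ∈ LinearMap.eqLocus f g)

/-- First-order estimates on states extend to all operators. -/
theorem isLittleO_of_states {E : Type*} [NormedAddCommGroup E] [NormedSpace ℂ E]
    {f : ℝ → Op ι →ₗ[ℂ] E} {l : Filter ℝ} {u : ℝ → ℝ}
    (h : ∀ ρ, IsState ρ → (fun t => f t ρ) =o[l] u) (X : Op ι) : (fun t => f t X) =o[l] u := by
  let p : Submodule ℂ (Op ι) :=
    { carrier := {X | (fun t => f t X) =o[l] u}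
      add_mem' := fun {X Y} hX hY => by simpa only [Set.mem_ofPred_eq, map_add] using hX.add hY
      zero_mem' := by simp only [Set.mem_ofPred_eq, map_zero]; exact isLittleO_zero _ _
      smul_mem' := fun c X hX => by
        simp only [Set.mem_ofPred_eq, map_smul]
        exact IsLittleO.const_smul_left hX c }
  have : p = ⊤ := eq_top_of_states_mem h
  exact (this ▸ Submodule.mem_top : X ∈ p)

/-- On a finite-dimensional space, a pointwise little-o estimate of operators is uniform. -/
theorem norm_isLittleO_of_forall {E F : Type*} [NormedAddCommGroup E] [NormedSpace ℂ E]
    [FiniteDimensional ℂ E] [NormedAddCommGroup F] [NormedSpace ℂ F]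
    {f : ℝ → E →L[ℂ] F} {l : Filter ℝ} {u : ℝ → ℝ}
    (h : ∀ X, (fun t => f t X) =o[l] u) : f =o[l] u := by
  let b := Module.finBasis ℂ E
  obtain ⟨C, hC, hb⟩ := b.exists_opNorm_le (F := F)
  have h1 : (fun t => ∑ i, ‖f t (b i)‖) =o[l] u :=
    IsLittleO.fun_sum fun i _ => (h (b i)).norm_left
  refine IsBigO.trans_isLittleO (IsBigO.of_bound C (Eventually.of_forall fun t => ?_)) h1
  rw [Real.norm_of_nonneg (by positivity)]
  exact hb (by positivity) fun i =>
    Finset.single_le_sum (f := fun i => ‖f t (b i)‖) (fun _ _ => norm_nonneg _) (Finset.mem_univ i)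

/-- A positive semidefinite Choi matrix `C` has a Kraus decomposition. -/
theorem exists_kraus {d : ℕ} {C : Op (Fin d × Fin d)} (hC : C.PosSemidef) :
    ∃ V : Fin (d * d) → Op (Fin d), ∀ (X : Op (Fin d)) (a b : Fin d),
      ∑ i, ∑ j, C (a, i) (b, j) * X i j = (∑ m, V m * X * (V m)ᴴ) a b := by
  obtain ⟨B, rfl⟩ := posSemidef_exists_eq hC
  refine ⟨fun m => of fun a i => star (B (finProdFinEquiv.symm m) (a, i)), fun X a b => ?_⟩
  rw [finProdFinEquiv.symm.sum_comp (fun m => (of fun a i => star (B m (a, i))) * X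
    * (of fun a i => star (B m (a, i)))ᴴ)]
  rw [Matrix.sum_apply]
  simp only [mul_apply, conjTranspose_apply, of_apply, star_star, Finset.sum_mul]
  rw [Finset.sum_comm]
  conv_rhs => rw [Finset.sum_comm]
  refine Finset.sum_congr rfl fun j _ => ?_
  rw [Finset.sum_comm]
  exact Finset.sum_congr rfl fun m _ => Finset.sum_congr rfl fun i _ => by ring

end PosSemidef

noncomputable section

/-! ### Blocks with respect to the register -/

variable {d N : ℕ}

/-- The block `⟨r| X |s⟩` of an operator on clockwork and register. -/
def blk (r s : Fin (N + 1)) : Op (CR d N) →L[ℂ] Op (Fin d) :=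
  LinearMap.toContinuousLinearMap
    { toFun := fun X => X.submatrix (fun a => (a, r)) (fun a => (a, s))
      map_add' := fun _ _ => rfl
      map_smul' := fun _ _ => rfl }

/-- The map `X ↦ X ⊗ |k⟩⟨k|`. -/
def emb (k : Fin (N + 1)) : Op (Fin d) →L[ℂ] Op (CR d N) :=
  LinearMap.toContinuousLinearMap
    { toFun := fun X => X ⊗ₖ proj k
      map_add' := fun X Y => add_kronecker X Y _
      map_smul' := fun c X => smul_kronecker c X _ }

/-- The trace as a continuous functional. -/
def traceCLM (ι : Type) [Fintype ι] [DecidableEq ι] : Op ι →L[ℂ] ℂ :=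
  LinearMap.toContinuousLinearMap (Matrix.traceLinearMap ι ℂ ℂ)

@[simp] theorem traceCLM_apply {ι : Type} [Fintype ι] [DecidableEq ι] (X : Op ι) :
    traceCLM ι X = X.trace := rfl

theorem blk_apply (r s : Fin (N + 1)) (X : Op (CR d N)) (a b : Fin d) :
    blk r s X a b = X (a, r) (b, s) := rfl

theorem emb_eq (k : Fin (N + 1)) (X : Op (Fin d)) : emb k X = X ⊗ₖ proj k := rfl

theorem emb_apply (k r s : Fin (N + 1)) (X : Op (Fin d)) (a b : Fin d) :
    emb k X (a, r) (b, s) = if k = r ∧ k = s then X a b else 0 := by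
  simp [emb_eq, kroneckerMap_apply, proj, Matrix.single_apply]

theorem blk_emb (k r s : Fin (N + 1)) (X : Op (Fin d)) :
    blk r s (emb k X) = if k = r ∧ k = s then X else 0 := by
  ext a b
  rw [blk_apply, emb_apply]
  split_ifs <;> rfl

theorem blk_diag_emb (k n : Fin (N + 1)) (X : Op (Fin d)) :
    blk n n (emb k X) = if k = n then X else 0 := by
  simp only [blk_emb, and_self]

theorem blk_posSemidef {X : Op (CR d N)} (hX : X.PosSemidef) (n : Fin (N + 1)) :
    (blk n n X).PosSemidef := hX.submatrix _

theorem proj_posSemidef (k : Fin (N + 1)) : (proj k).PosSemidef := by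
  have : proj k = (proj k)ᴴ * proj k := by simp [proj]
  rw [this]
  exact posSemidef_conjTranspose_mul_self _

theorem emb_posSemidef {X : Op (Fin d)} (hX : X.PosSemidef) (k : Fin (N + 1)) :
    (emb k X).PosSemidef := hX.kronecker (proj_posSemidef k)

theorem trace_eq_sum_blk (X : Op (CR d N)) : X.trace = ∑ n, (blk n n X).trace := by
  simp only [Matrix.trace, diag_apply, blk_apply, Fintype.sum_prod_type]
  exact Finset.sum_comm

theorem trace_emb (k : Fin (N + 1)) (X : Op (Fin d)) : (emb k X).trace = X.trace := by
  rw [trace_eq_sum_blk, Finset.sum_eq_single k]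
  · rw [blk_diag_emb, if_pos rfl]
  · intro n _ hn
    rw [blk_diag_emb, if_neg hn.symm, trace_zero]
  · simp

theorem IsState.emb {ρ : Op (Fin d)} (hρ : IsState ρ) (k : Fin (N + 1)) :
    IsState (emb k ρ) :=
  ⟨emb_posSemidef hρ.posSemidef k, (trace_emb k ρ).trans hρ.trace_eq_one⟩

theorem ptraceC_apply (X : Op (CR d N)) (r s : Fin (N + 1)) :
    ptraceC X r s = (blk r s X).trace := rfl

theorem clockBlock_eq (M : ℝ → SuperOp (CR d N)) (t : ℝ) (k n : Fin (N + 1)) (X : Op (Fin d)) :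
    clockBlock M t k n X = blk n n (M t (emb k X)) := by
  ext a b
  simp only [clockBlock, ptraceR, of_apply, fromTick, ← emb_eq, blk_apply, mul_apply,
    Fintype.sum_prod_type, emb_apply]
  rw [Finset.sum_eq_single n]
  · rw [Finset.sum_eq_single b]
    · simp
    · intro c _ hc
      simp [hc]
    · simp
  · intro r _ hr
    simp [hr.symm]
  · simp

theorem tickProb_eq (M : ℝ → SuperOp (CR d N)) (ρ : Op (Fin d)) (k n : Fin (N + 1)) (t : ℝ) :
    tickProb M ρ k n t = (blk n n (M t (emb k ρ))).trace.re := by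
  rw [← clockBlock_eq, clockBlock, tickProb]
  congr 1
  simp only [Matrix.trace, diag_apply, ptraceR, of_apply, Fintype.sum_prod_type]

/-- The operators that are block diagonal with respect to the register. -/
def blockDiag (d N : ℕ) : Submodule ℂ (Op (CR d N)) where
  carrier := {X | ∀ r s, r ≠ s → blk r s X = 0}
  add_mem' := fun {X Y} hX hY r s h => by rw [map_add, hX r s h, hY r s h, add_zero]
  zero_mem' := fun r s _ => map_zero _
  smul_mem' := fun c X hX r s h => by rw [map_smul, hX r s h, smul_zero]

theorem emb_mem_blockDiag (k : Fin (N + 1)) (X : Op (Fin d)) : emb k X ∈ blockDiag d N := by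
  intro r s h
  rw [blk_emb, if_neg]
  rintro ⟨rfl, rfl⟩
  exact h rfl

theorem isClosed_blockDiag : IsClosed (blockDiag d N : Set (Op (CR d N))) :=
  Submodule.closed_of_finiteDimensional _

theorem eq_of_blk_eq {X Y : Op (CR d N)} (h : ∀ r s, blk r s X = blk r s Y) : X = Y := by
  ext ⟨a, r⟩ ⟨b, s⟩
  exact congr_fun (congr_fun (h r s) a) b

theorem eq_of_mem_blockDiag {X Y : Op (CR d N)} (hX : X ∈ blockDiag d N)
    (hY : Y ∈ blockDiag d N) (h : ∀ n, blk n n X = blk n n Y) : X = Y := by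
  refine eq_of_blk_eq fun r s => ?_
  by_cases hrs : r = s
  · rw [hrs, h]
  · rw [hX r s hrs, hY r s hrs]

theorem eq_sum_emb {X : Op (CR d N)} (hX : X ∈ blockDiag d N) :
    X = ∑ n, emb n (blk n n X) := by
  refine eq_of_mem_blockDiag hX (Submodule.sum_mem _ fun n _ => emb_mem_blockDiag n _) fun m => ?_
  simp [map_sum, blk_diag_emb]

/-- The inputs `X ⊗ |k⟩⟨k|` evolve into block-diagonal operators exactly when the register is
classical. -/
theorem HasClassicalRegister.mem_blockDiag {M : ℝ → SuperOp (CR d N)}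
    (hM : HasClassicalRegister M) {t : ℝ} (ht : 0 ≤ t) (k : Fin (N + 1)) (X : Op (Fin d)) :
    M t (emb k X) ∈ blockDiag d N := by
  have : (blockDiag d N).comap ((M t).comp (emb k)).toLinearMap = ⊤ := by
    refine eq_top_of_states_mem fun ρ hρ => ?_
    obtain ⟨σ, -, h⟩ := hM t ht ρ hρ k
    rw [Submodule.mem_comap]
    change fromTick M t k ρ ∈ _
    rw [h]
    exact Submodule.sum_mem _ fun n _ => emb_mem_blockDiag n _
  exact (this ▸ Submodule.mem_top :
    X ∈ (blockDiag d N).comap ((M t).comp (emb k)).toLinearMap)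

end

noncomputable section

/-! ### Completely positive maps and Lindblad generators -/

section Lindblad

variable {ι : Type} [Fintype ι]

/-- Complete positivity of a superoperator. -/
def IsCP (Φ : SuperOp ι) : Prop :=
  ∀ (n : ℕ) (X : Op (ι × Fin n)), X.PosSemidef → (ampliate Φ n X).PosSemidef

theorem IsCP.mul {Φ Ψ : SuperOp ι} (hΦ : IsCP Φ) (hΨ : IsCP Ψ) : IsCP (Φ * Ψ) :=
  fun n X hX => hΦ n _ (hΨ n X hX)

theorem isCP_one : IsCP (1 : SuperOp ι) := fun _ _ hX => hX

theorem IsCP.pow {Φ : SuperOp ι} (hΦ : IsCP Φ) (n : ℕ) : IsCP (Φ ^ n) := by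
  induction n with
  | zero => exact isCP_one
  | succ n ih => rw [pow_succ]; exact ih.mul hΦ

theorem IsCP.add {Φ Ψ : SuperOp ι} (hΦ : IsCP Φ) (hΨ : IsCP Ψ) : IsCP (Φ + Ψ) :=
  fun n X hX => (hΦ n X hX).add (hΨ n X hX)

theorem IsCP.smul {Φ : SuperOp ι} (hΦ : IsCP Φ) {s : ℝ} (hs : 0 ≤ s) : IsCP (s • Φ) :=
  fun n X hX => (hΦ n X hX).smul hs

theorem IsCP.posSemidef {Φ : SuperOp ι} (hΦ : IsCP Φ) {X : Op ι} (hX : X.PosSemidef) :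
    (Φ X).PosSemidef :=
  (hΦ 1 (X.submatrix Prod.fst Prod.fst) (hX.submatrix _)).submatrix
    (fun a : ι => (a, (0 : Fin 1)))

theorem isCP_zero : IsCP (0 : SuperOp ι) := fun _ _ _ => PosSemidef.zero

theorem IsCP.sum {α : Type*} {s : Finset α} {Φ : α → SuperOp ι} (h : ∀ j ∈ s, IsCP (Φ j)) :
    IsCP (∑ j ∈ s, Φ j) :=
  Finset.sum_induction _ _ (fun _ _ => IsCP.add) isCP_zero h

variable [DecidableEq ι]

theorem continuous_ampliate (n : ℕ) (X : Op (ι × Fin n)) :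
    Continuous fun Φ : SuperOp ι => ampliate Φ n X := by
  refine continuous_matrix fun p q => ?_
  have h : Continuous fun Ψ : SuperOp ι => Ψ (of fun a b => X (a, p.2) (b, q.2)) :=
    (ContinuousLinearMap.apply ℂ (Op ι) (of fun a b => X (a, p.2) (b, q.2))).continuous
  exact h.matrix_elem p.1 q.1

theorem IsCP.of_tendsto {α : Type*} {l : Filter α} [l.NeBot] {F : α → SuperOp ι}
    {Φ : SuperOp ι} (h : Tendsto F l (𝓝 Φ)) (hF : ∀ᶠ t in l, IsCP (F t)) : IsCP Φ := by
  intro n X hX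
  refine posSemidef_of_tendsto (((continuous_ampliate n X).tendsto Φ).comp h) ?_
  filter_upwards [hF] with t ht using ht n X hX

/-- The superoperator `X ↦ A X A†`. -/
def conjBy (A : Op ι) : SuperOp ι :=
  LinearMap.toContinuousLinearMap ((LinearMap.mulLeft ℂ A).comp (LinearMap.mulRight ℂ Aᴴ))

theorem conjBy_apply (A X : Op ι) : conjBy A X = A * X * Aᴴ := (Matrix.mul_assoc _ _ _).symm

theorem isCP_conjBy (A : Op ι) : IsCP (conjBy A) := by
  intro n X hX
  have : ampliate (conjBy A) n X
      = (A ⊗ₖ (1 : Op (Fin n))) * X * (A ⊗ₖ (1 : Op (Fin n)))ᴴ := by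
    ext ⟨a, r⟩ ⟨b, s⟩
    simp only [ampliate, of_apply, conjBy_apply, mul_apply, conjTranspose_apply,
      kroneckerMap_apply, Fintype.sum_prod_type, one_apply, mul_ite, mul_one, mul_zero,
      ite_mul, zero_mul, Finset.sum_ite_eq, Finset.mem_univ, if_true, apply_ite star, star_zero]
  rw [this]
  exact hX.mul_mul_conjTranspose_same _

/-- The Lindblad generator with Hamiltonian `H` and jump operators `V j`. -/
def lindbladian {α : Type*} [Fintype α] (H : Op ι) (V : α → Op ι) : SuperOp ι :=
  LinearMap.toContinuousLinearMap (hamiltonianPart H + ∑ j, dissipator (V j))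

theorem hamiltonianPart_apply (H X : Op ι) :
    hamiltonianPart H X = (-Complex.I) • (H * X - X * H) := rfl

theorem dissipator_apply (V X : Op ι) :
    dissipator V X = V * X * Vᴴ - (1 / 2 : ℂ) • (Vᴴ * V * X + X * (Vᴴ * V)) := by
  rw [Matrix.mul_assoc V]; rfl

theorem lindbladian_apply {α : Type*} [Fintype α] (H : Op ι) (V : α → Op ι) (X : Op ι) :
    lindbladian H V X = hamiltonianPart H X + ∑ j, dissipator (V j) X := by
  simp [lindbladian]

theorem trace_hamiltonianPart (H X : Op ι) : (hamiltonianPart H X).trace = 0 := by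
  rw [hamiltonianPart_apply, trace_smul, trace_sub, trace_mul_comm, sub_self, smul_zero]

theorem trace_dissipator (V X : Op ι) : (dissipator V X).trace = 0 := by
  rw [dissipator_apply, trace_sub, trace_smul, trace_add, trace_mul_comm X, Matrix.trace_mul_comm,
    ← Matrix.mul_assoc, smul_eq_mul]
  ring

theorem trace_lindbladian {α : Type*} [Fintype α] (H : Op ι) (V : α → Op ι) (X : Op ι) :
    (lindbladian H V X).trace = 0 := by
  rw [lindbladian_apply, trace_add, trace_hamiltonianPart, trace_sum]
  simp [trace_dissipator]

/-- The Euler step `X ↦ (1 + s K) X (1 + s K)† + s ∑ V X V†` with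
`K = -i H - ½ ∑ V† V` agrees with `1 + s 𝓛` to first order. -/
theorem euler_step_eq {α : Type*} [Fintype α] {H : Op ι} (hH : H.IsHermitian) (V : α → Op ι)
    (s : ℝ) :
    conjBy (1 + s • ((-Complex.I) • H - (1 / 2 : ℂ) • ∑ j, (V j)ᴴ * V j))
        + s • ∑ j, conjBy (V j)
      = 1 + s • lindbladian H V
        + s ^ 2 • conjBy ((-Complex.I) • H - (1 / 2 : ℂ) • ∑ j, (V j)ᴴ * V j) := by
  set K : Op ι := (-Complex.I) • H - (1 / 2 : ℂ) • ∑ j, (V j)ᴴ * V j with hK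
  have hKH : Kᴴ = Complex.I • H - (1 / 2 : ℂ) • ∑ j, (V j)ᴴ * V j := by
    simp [hK, conjTranspose_sub, conjTranspose_smul, conjTranspose_sum, hH.eq]
  ext1 X
  have hL : lindbladian H V X = K * X + X * Kᴴ + ∑ j, V j * X * (V j)ᴴ := by
    rw [lindbladian_apply, hamiltonianPart_apply, hKH, hK]
    simp only [dissipator_apply, Finset.sum_sub_distrib, ← Finset.smul_sum,
      Finset.sum_add_distrib, sub_mul, mul_sub, Finset.sum_mul, Finset.mul_sum, smul_mul_assoc,
      mul_smul_comm, smul_add, smul_sub, neg_smul, neg_mul]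
    abel
  simp only [_root_.add_apply, _root_.smul_apply,
    _root_.sum_apply, one_apply_eq_self, conjBy_apply, hL,
    conjTranspose_add, conjTranspose_smul, conjTranspose_one, star_trivial, add_mul, mul_add,
    one_mul, mul_one, smul_mul_assoc, mul_smul_comm, smul_add, smul_smul, sq]
  abel

/-- The semigroup generated by a Lindblad generator consists of channels: it is the limit of powers
of completely positive Euler steps. -/
theorem isChannel_exp_lindbladian [Nonempty ι] {α : Type*} [Fintype α] {H : Op ι}
    (hH : H.IsHermitian) (V : α → Op ι) {t : ℝ} (ht : 0 ≤ t) :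
    IsChannel (NormedSpace.exp (t • lindbladian H V)) := by
  constructor
  · change IsCP _
    set K : Op ι := (-Complex.I) • H - (1 / 2 : ℂ) • ∑ j, (V j)ᴴ * V j
    have h := tendsto_euler_pow_exp (t • lindbladian H V) (t ^ 2 • conjBy K)
    refine IsCP.of_tendsto h (Eventually.of_forall fun n => IsCP.pow ?_ n)
    have hn : (0 : ℝ) ≤ (n : ℝ)⁻¹ * t := by positivity
    have := euler_step_eq hH V ((n : ℝ)⁻¹ * t)
    rw [smul_smul, smul_smul, ← mul_pow, ← this]
    exact (isCP_conjBy _).add ((IsCP.sum fun j _ => isCP_conjBy (V j)).smul hn)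
  · intro X
    have h := exp_intertwine (p := ⊤) (G := t • lindbladian H V) (G' := 0) (traceCLM ι)
      (fun _ _ => Submodule.mem_top) (fun Y _ => by
        simp only [_root_.smul_apply, traceCLM_apply, trace_smul, trace_lindbladian,
          smul_zero, _root_.zero_apply]) (Submodule.mem_top (x := X))
    rw [NormedSpace.exp_zero] at h
    exact h

end Lindblad

/-! ### The generator on block-diagonal operators -/

section Generator

variable {d N m : ℕ}

/-- The weight of the transition `k → k + 1` in the tick operator: it is `0` for the wrap-around
transition of a cut-off register, and `1` otherwise. -/
def tickWeight (κ : RegisterKind) (k : Fin (N + 1)) : ℂ :=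
  if k = Fin.last N then κ.wrap else 1

theorem tickWeight_periodic (k : Fin (N + 1)) : tickWeight .periodic k = 1 := by
  simp [tickWeight, RegisterKind.wrap]

theorem tickWeight_of_ne_last (κ : RegisterKind) {k : Fin (N + 1)} (hk : k ≠ Fin.last N) :
    tickWeight κ k = 1 := if_neg hk

theorem tickWeight_cutOff_last : tickWeight .cutOff (Fin.last N) = 0 := if_pos rfl

theorem star_tickWeight (κ : RegisterKind) (k : Fin (N + 1)) :
    star (tickWeight κ k) = tickWeight κ k := by
  cases κ <;> simp [tickWeight, RegisterKind.wrap, apply_ite (starRingEnd ℂ)]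

theorem tickWeight_mul_self (κ : RegisterKind) (k : Fin (N + 1)) :
    tickWeight κ k * tickWeight κ k = tickWeight κ k := by
  cases κ <;> simp [tickWeight, RegisterKind.wrap]

theorem shiftOp_apply (κ : RegisterKind) (i j : Fin (N + 1)) :
    shiftOp N κ i j = if i = j + 1 then tickWeight κ j else 0 := by
  rw [shiftOp, Matrix.add_apply, Matrix.smul_apply, Matrix.sum_apply]
  induction j using Fin.lastCases with
  | last =>
    simp [tickWeight, Matrix.single_apply, eq_comm]
  | cast j =>
    have h0 : Matrix.single (0 : Fin (N + 1)) (Fin.last N) (1 : ℂ) i j.castSucc = 0 := by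
      rw [Matrix.single_apply, if_neg]
      exact fun h => (Fin.castSucc_lt_last j).ne h.2.symm
    rw [h0, smul_zero, add_zero, tickWeight_of_ne_last κ (Fin.castSucc_lt_last j).ne,
      Finset.sum_eq_single j, Matrix.single_apply]
    · simp [Fin.coeSucc_eq_succ, eq_comm]
    · intro k _ hk
      rw [Matrix.single_apply, if_neg]
      exact fun h => hk (Fin.castSucc_injective _ h.2)
    · simp

theorem shiftOp_conjTranspose_mul_self (κ : RegisterKind) :
    (shiftOp N κ)ᴴ * shiftOp N κ = diagonal (tickWeight κ) := by
  ext i j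
  simp only [mul_apply, conjTranspose_apply, shiftOp_apply, mul_ite, mul_zero, Finset.sum_ite_eq',
    Finset.mem_univ, if_true, add_left_inj, diagonal_apply, eq_comm (a := j)]
  split_ifs with h
  · rw [h, star_tickWeight, tickWeight_mul_self]
  · rw [star_zero, zero_mul]

theorem shiftOp_mul_proj_mul (κ : RegisterKind) (k : Fin (N + 1)) :
    shiftOp N κ * proj k * (shiftOp N κ)ᴴ = tickWeight κ k • proj (k + 1) := by
  have h1 : shiftOp N κ * proj k = tickWeight κ k • Matrix.single (k + 1) k 1 := by
    ext i j
    rw [mul_apply, Matrix.smul_apply, Finset.sum_eq_single k, shiftOp_apply]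
    · simp only [proj, Matrix.single_apply, true_and, eq_comm (a := i), ite_and]
      split_ifs <;> simp
    · intro r _ hr
      rw [proj, Matrix.single_apply, if_neg (fun h => hr h.1.symm), mul_zero]
    · simp
  have h2 : proj k = proj k * (proj k)ᴴ := by simp [proj]
  rw [h2, ← Matrix.mul_assoc, Matrix.mul_assoc _ _ (shiftOp N κ)ᴴ, ← conjTranspose_mul, h1,
    conjTranspose_smul, smul_mul_smul_comm, star_tickWeight, tickWeight_mul_self]
  simp [proj]

theorem diagonal_mul_proj (w : Fin (N + 1) → ℂ) (k : Fin (N + 1)) :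
    diagonal w * proj k = w k • proj k := by
  ext i j
  rw [diagonal_mul, Matrix.smul_apply, proj, Matrix.single_apply, smul_eq_mul]
  split_ifs with h
  · rw [h.1]
  · simp

theorem proj_mul_diagonal (w : Fin (N + 1) → ℂ) (k : Fin (N + 1)) :
    proj k * diagonal w = w k • proj k := by
  ext i j
  rw [mul_diagonal, Matrix.smul_apply, proj, Matrix.single_apply, smul_eq_mul]
  split_ifs with h
  · rw [h.2, mul_comm]
  · simp

/-- The part of the clockwork dynamics that does not involve ticks. -/
def noTickPart (H : Op (Fin d)) (L : Fin m → Op (Fin d)) : SuperOp (Fin d) := lindbladian H L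

/-- The tick map `X ↦ ∑ J X J†` of the clockwork. -/
def tickPart (J : Fin m → Op (Fin d)) : SuperOp (Fin d) := ∑ j, conjBy (J j)

/-- The map `X ↦ ½ {∑ J† J, X}` describing the loss of weight due to ticks, written as what a
dissipator with jump operators `J` takes away from their jump term (see `lossPart_apply`). -/
def lossPart (J : Fin m → Op (Fin d)) : SuperOp (Fin d) := tickPart J - lindbladian 0 J

theorem tickPart_apply (J : Fin m → Op (Fin d)) (X : Op (Fin d)) :
    tickPart J X = ∑ j, J j * X * (J j)ᴴ := by
  simp [tickPart, conjBy_apply]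

theorem lossPart_apply (J : Fin m → Op (Fin d)) (X : Op (Fin d)) :
    lossPart J X = ∑ j, (1 / 2 : ℂ) • ((J j)ᴴ * J j * X + X * ((J j)ᴴ * J j)) := by
  rw [lossPart, _root_.sub_apply, tickPart_apply, lindbladian_apply,
    hamiltonianPart_apply]
  simp [dissipator_apply]

theorem trace_lossPart (J : Fin m → Op (Fin d)) (X : Op (Fin d)) :
    (lossPart J X).trace = (tickPart J X).trace := by
  rw [lossPart, _root_.sub_apply, trace_sub, trace_lindbladian, sub_zero]

theorem generator_eq_lindbladian (κ : RegisterKind) (H : Op (Fin d)) (L J : Fin m → Op (Fin d)) :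
    (generator κ H L J : SuperOp (CR d N)) = lindbladian (H ⊗ₖ (1 : Op (Fin (N + 1))))
      (Sum.elim (fun j => L j ⊗ₖ (1 : Op (Fin (N + 1)))) fun j => J j ⊗ₖ shiftOp N κ) := by
  rw [generator, lindbladian, Fintype.sum_sum_type, ← add_assoc]
  rfl

/-- In the generator, a tick from `k` moves the register to `k + 1`, with the weight given by
`tickWeight`; everything else leaves the register in `k`. -/
theorem generator_emb (κ : RegisterKind) (H : Op (Fin d)) (L J : Fin m → Op (Fin d))
    (k : Fin (N + 1)) (X : Op (Fin d)) :
    generator κ H L J (emb k X) = emb k (noTickPart H L X - tickWeight κ k • lossPart J X)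
      + tickWeight κ k • emb (k + 1) (tickPart J X) := by
  have hHam : hamiltonianPart (H ⊗ₖ (1 : Op (Fin (N + 1)))) (emb k X)
      = emb k (hamiltonianPart H X) := by
    rw [hamiltonianPart_apply, hamiltonianPart_apply, map_smul, map_sub, emb_eq, emb_eq, emb_eq,
      ← mul_kronecker_mul, ← mul_kronecker_mul, one_mul, mul_one]
  have hL : ∀ V : Op (Fin d), dissipator (V ⊗ₖ (1 : Op (Fin (N + 1)))) (emb k X)
      = emb k (dissipator V X) := by
    intro V
    simp only [dissipator_apply, map_smul, map_sub, map_add, emb_eq, conjTranspose_kronecker,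
      conjTranspose_one, ← mul_kronecker_mul, one_mul, mul_one]
  have hJ : ∀ V : Op (Fin d), dissipator (V ⊗ₖ shiftOp N κ) (emb k X)
      = tickWeight κ k • emb (k + 1) (V * X * Vᴴ)
        - tickWeight κ k • emb k ((1 / 2 : ℂ) • (Vᴴ * V * X + X * (Vᴴ * V))) := by
    intro V
    simp only [dissipator_apply, map_smul, map_add, emb_eq, conjTranspose_kronecker,
      ← mul_kronecker_mul, shiftOp_conjTranspose_mul_self, shiftOp_mul_proj_mul,
      diagonal_mul_proj, proj_mul_diagonal, kronecker_smul, smul_add, smul_comm (1 / 2 : ℂ)]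
  rw [generator_eq_lindbladian, lindbladian_apply, Fintype.sum_sum_type, hHam, noTickPart,
    lindbladian_apply, tickPart_apply, lossPart_apply]
  simp only [Sum.elim_inl, Sum.elim_inr, hL, hJ, map_sub, map_add, map_smul, map_sum,
    Finset.sum_sub_distrib, Finset.smul_sum, smul_add]
  abel

theorem generator_mem_blockDiag (κ : RegisterKind) (H : Op (Fin d)) (L J : Fin m → Op (Fin d))
    {X : Op (CR d N)} (hX : X ∈ blockDiag d N) : generator κ H L J X ∈ blockDiag d N := by
  rw [eq_sum_emb hX, map_sum]
  refine Submodule.sum_mem _ fun n _ => ?_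
  rw [generator_emb]
  exact Submodule.add_mem _ (emb_mem_blockDiag _ _)
    (Submodule.smul_mem _ _ (emb_mem_blockDiag _ _))

end Generator

end

noncomputable section

variable {d N m : ℕ}

/-! ### Lindblad semigroups are ticking clocks -/

theorem lindbladSemigroup_eq (κ : RegisterKind) (H : Op (Fin d)) (L J : Fin m → Op (Fin d))
    (t : ℝ) : (lindbladSemigroup κ H L J t : SuperOp (CR d N))
      = NormedSpace.exp (t • (generator κ H L J : SuperOp (CR d N))) := rfl

theorem isChannel_lindbladSemigroup (hd : 0 < d) (κ : RegisterKind) {H : Op (Fin d)}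
    (hH : H.IsHermitian) (L J : Fin m → Op (Fin d)) {t : ℝ} (ht : 0 ≤ t) :
    IsChannel (lindbladSemigroup κ H L J t : SuperOp (CR d N)) := by
  have : Nonempty (CR d N) := ⟨(⟨0, hd⟩, 0)⟩
  have hH' : (H ⊗ₖ (1 : Op (Fin (N + 1)))).IsHermitian := by
    rw [IsHermitian, conjTranspose_kronecker, conjTranspose_one, hH.eq]
  rw [lindbladSemigroup_eq, generator_eq_lindbladian]
  exact isChannel_exp_lindbladian hH' _ ht

theorem selfTiming_lindbladSemigroup (κ : RegisterKind) (H : Op (Fin d))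
    (L J : Fin m → Op (Fin d)) :
    SelfTiming (lindbladSemigroup κ H L J : ℝ → SuperOp (CR d N)) := by
  intro s t _ _
  rw [add_comm s t]
  exact exp_add_smul (generator κ H L J) t s

/-- First-order expansion of an exponential semigroup at time `0`, evaluated on an operator. -/
theorem exp_smul_apply_isLittleO {E : Type*} [NormedAddCommGroup E] [NormedSpace ℂ E]
    [CompleteSpace E] (G : E →L[ℂ] E) (x : E) :
    (fun t : ℝ => NormedSpace.exp (t • G) x - x - t • G x) =o[𝓝[>] 0] (fun t : ℝ => t) := by
  have h := (exp_smul_isLittleO G).mono (nhdsWithin_le_nhds (s := Set.Ioi (0 : ℝ)))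
  refine IsBigO.trans_isLittleO (IsBigO.of_bound ‖x‖ (Eventually.of_forall fun t => ?_)) h
  rw [mul_comm]
  exact (NormedSpace.exp (t • G) - 1 - t • G).le_opNorm x

theorem hasDerivAt_exp_smul_apply {E F : Type*} [NormedAddCommGroup E] [NormedSpace ℂ E]
    [CompleteSpace E] [NormedAddCommGroup F] [NormedSpace ℂ F] (G : E →L[ℂ] E) (φ : E →L[ℂ] F)
    (x : E) (t : ℝ) :
    HasDerivAt (fun s : ℝ => φ (NormedSpace.exp (s • G) x))
      (φ (G (NormedSpace.exp (t • G) x))) t := by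
  have h : HasDerivAt (fun s : ℝ => NormedSpace.exp (s • G)) (G * NormedSpace.exp (t • G)) t :=
    hasDerivAt_exp_smul_const' G t
  have h2 := ((φ.comp (ContinuousLinearMap.apply ℂ E x)).restrictScalars
    ℝ).hasFDerivAt.comp_hasDerivAt t h
  exact h2

theorem tendsto_exp_smul {𝔸 : Type*} [NormedRing 𝔸] [NormedAlgebra ℝ 𝔸] [CompleteSpace 𝔸]
    (G : 𝔸) : Tendsto (fun t : ℝ => NormedSpace.exp (t • G)) (𝓝[>] 0) (𝓝 1) := by
  have h := (hasDerivAt_exp_smul G 0).continuousAt.tendsto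
  rw [zero_smul, NormedSpace.exp_zero] at h
  exact h.mono_left nhdsWithin_le_nhds

theorem zerothOrder_lindbladSemigroup (κ : RegisterKind) (H : Op (Fin d))
    (L J : Fin m → Op (Fin d)) :
    ZerothOrder (lindbladSemigroup κ H L J : ℝ → SuperOp (CR d N)) := by
  exact ⟨exp_zero_smul (generator κ H L J),
    tendsto_iff_norm_sub_tendsto_zero.1 (tendsto_exp_smul (generator κ H L J))⟩

theorem lindbladSemigroup_mem_blockDiag (κ : RegisterKind) (H : Op (Fin d))
    (L J : Fin m → Op (Fin d)) (t : ℝ) {X : Op (CR d N)} (hX : X ∈ blockDiag d N) :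
    lindbladSemigroup κ H L J t X ∈ blockDiag d N :=
  exp_smul_apply_mem isClosed_blockDiag (fun _ hY => generator_mem_blockDiag κ H L J hY) t hX

theorem IsChannel.posSemidef {ι : Type} [Fintype ι] {Φ : SuperOp ι} (hΦ : IsChannel Φ) {X : Op ι}
    (hX : X.PosSemidef) : (Φ X).PosSemidef :=
  IsCP.posSemidef hΦ.completelyPositive hX

theorem IsChannel.isState {ι : Type} [Fintype ι] {Φ : SuperOp ι} (hΦ : IsChannel Φ) {ρ : Op ι}
    (hρ : IsState ρ) : IsState (Φ ρ) :=
  ⟨hΦ.posSemidef hρ.posSemidef, (hΦ.tracePreserving ρ).trans hρ.trace_eq_one⟩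

theorem IsState.sum_re_trace_blk {ρ : Op (CR d N)} (hρ : IsState ρ) :
    ∑ n, (blk n n ρ).trace.re = 1 := by
  rw [← Complex.re_sum, ← trace_eq_sum_blk, hρ.trace_eq_one, Complex.one_re]

theorem IsState.re_trace_blk_nonneg {ρ : Op (CR d N)} (hρ : IsState ρ) (n : Fin (N + 1)) :
    0 ≤ (blk n n ρ).trace.re :=
  posSemidef_re_trace_nonneg (blk_posSemidef hρ.posSemidef n)

theorem IsState.isSubState_blk {ρ : Op (CR d N)} (hρ : IsState ρ) (n : Fin (N + 1)) :
    IsSubState (blk n n ρ) := by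
  refine ⟨blk_posSemidef hρ.posSemidef n, ?_⟩
  rw [← hρ.sum_re_trace_blk]
  exact Finset.single_le_sum (f := fun n => (blk n n ρ).trace.re)
    (fun n _ => hρ.re_trace_blk_nonneg n) (Finset.mem_univ n)

theorem hasClassicalRegister_lindbladSemigroup (hd : 0 < d) (κ : RegisterKind) {H : Op (Fin d)}
    (hH : H.IsHermitian) (L J : Fin m → Op (Fin d)) :
    HasClassicalRegister (lindbladSemigroup κ H L J : ℝ → SuperOp (CR d N)) := by
  intro t ht ρ hρ k
  refine ⟨fun n => blk n n (lindbladSemigroup κ H L J t (emb k ρ)),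
    ((isChannel_lindbladSemigroup hd κ hH L J ht).isState (hρ.emb k)).isSubState_blk, ?_⟩
  exact eq_sum_emb (lindbladSemigroup_mem_blockDiag κ H L J t (emb_mem_blockDiag k ρ))

/-- The translation of the register by `c`. -/
def translate (c : Fin (N + 1)) : SuperOp (CR d N) :=
  LinearMap.toContinuousLinearMap
    { toFun := fun X => X.submatrix (fun p => (p.1, p.2 - c)) (fun p => (p.1, p.2 - c))
      map_add' := fun _ _ => rfl
      map_smul' := fun _ _ => rfl }

theorem blk_translate (c r s : Fin (N + 1)) (X : Op (CR d N)) :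
    blk r s (translate c X) = blk (r - c) (s - c) X := rfl

theorem translate_emb (c k : Fin (N + 1)) (X : Op (Fin d)) :
    translate c (emb k X) = emb (k + c) X := by
  refine eq_of_blk_eq fun r s => ?_
  rw [blk_translate, blk_emb, blk_emb]
  simp only [eq_sub_iff_add_eq]

/-- With the wrap-around tick, the generator commutes with the translations of the register on
block-diagonal operators. -/
theorem timeInvariance_lindbladSemigroup (H : Op (Fin d)) (L J : Fin m → Op (Fin d)) :
    TimeInvariance (lindbladSemigroup .periodic H L J : ℝ → SuperOp (CR d N)) := by
  intro t _ ρ _ l k k'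
  have h := exp_smul_intertwine (G' := generator .periodic H L J) (translate (k' - k))
    (fun _ hY => generator_mem_blockDiag .periodic H L J hY)
    (fun Y hY => by
      rw [eq_sum_emb hY]
      simp only [map_sum, translate_emb, generator_emb, tickWeight_periodic, one_smul, map_add]
      refine Finset.sum_congr rfl fun n _ => ?_
      rw [add_right_comm n 1])
    t (emb_mem_blockDiag k ρ)
  rw [translate_emb, add_sub_cancel] at h
  rw [clockBlock_eq, clockBlock_eq, lindbladSemigroup_eq, ← h, blk_translate]
  congr 2 <;> abel

theorem exists_tickPart_le (J : Fin m → Op (Fin d)) : ∃ C : ℝ, 0 ≤ C ∧ ∀ X : Op (Fin d),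
    X.PosSemidef → 0 ≤ (tickPart J X).trace.re ∧ (tickPart J X).trace.re ≤ C * X.trace.re := by
  obtain ⟨C, hC, h⟩ := exists_norm_le_mul_trace (ι := Fin d)
  refine ⟨‖(traceCLM (Fin d)).comp (tickPart J)‖ * C, by positivity, fun X hX => ⟨?_, ?_⟩⟩
  · rw [tickPart_apply]
    exact posSemidef_re_trace_nonneg
      (posSemidef_sum _ fun j _ => hX.mul_mul_conjTranspose_same (J j))
  · calc (tickPart J X).trace.re ≤ ‖(tickPart J X).trace‖ := Complex.re_le_norm _
      _ ≤ ‖(traceCLM (Fin d)).comp (tickPart J)‖ * ‖X‖ :=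
          ((traceCLM (Fin d)).comp (tickPart J)).le_opNorm X
      _ ≤ _ := by rw [mul_assoc]; gcongr; exact h X hX

theorem trace_blk_generator_periodic (H : Op (Fin d)) (L J : Fin m → Op (Fin d))
    (n : Fin (N + 1)) {X : Op (CR d N)} (hX : X ∈ blockDiag d N) :
    (blk n n (generator .periodic H L J X)).trace
      = (tickPart J (blk (n - 1) (n - 1) X)).trace - (tickPart J (blk n n X)).trace := by
  conv_lhs => rw [eq_sum_emb hX]
  simp only [map_sum, generator_emb, tickWeight_periodic, one_smul, map_add, blk_diag_emb,
    Finset.sum_add_distrib, ← eq_sub_iff_add_eq, Finset.sum_ite_eq', Finset.mem_univ, if_true]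
  rw [trace_add, trace_sub, trace_lossPart, noTickPart, trace_lindbladian]
  ring

/-- Leaving `k` by more than one step takes two ticks. The weight `p` of `k + 1` decays at most at
the rate `C` of ticks, and the weight of the further states grows at most at the rate `C p`, so that
up to time `t` it is at most `C t e^{C t} p t`. -/
theorem leadingOrder_lindbladSemigroup (hd : 0 < d) (hN : 0 < N) {H : Op (Fin d)}
    (hH : H.IsHermitian) (L J : Fin m → Op (Fin d)) :
    LeadingOrder (lindbladSemigroup .periodic H L J : ℝ → SuperOp (CR d N)) := by
  intro ρ hρ k
  obtain ⟨C, hC, hJ⟩ := exists_tickPart_le J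
  set G : SuperOp (CR d N) := generator .periodic H L J with hG
  set Z : ℝ → Op (CR d N) := fun t => NormedSpace.exp (t • G) (emb k ρ) with hZ
  have hst : ∀ t, 0 ≤ t → IsState (Z t) := fun t ht =>
    (isChannel_lindbladSemigroup hd .periodic hH L J ht).isState (hρ.emb k)
  have hW : ∀ t, Z t ∈ blockDiag d N := fun t =>
    lindbladSemigroup_mem_blockDiag _ H L J t (emb_mem_blockDiag k ρ)
  have hk : k + 1 ≠ k := by
    have : NeZero N := ⟨hN.ne'⟩
    simp
  set p : Fin (N + 1) → ℝ → ℝ := fun n t => (blk n n (Z t)).trace.re with hp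
  set b : Fin (N + 1) → ℝ → ℝ := fun n t => (tickPart J (blk n n (Z t))).trace.re with hb
  have hp0 : ∀ n t, 0 ≤ t → 0 ≤ p n t := fun n t ht => (hst t ht).re_trace_blk_nonneg n
  have hb0 : ∀ n t, 0 ≤ t → 0 ≤ b n t := fun n t ht =>
    (hJ _ (blk_posSemidef (hst t ht).posSemidef n)).1
  have hbp : ∀ n t, 0 ≤ t → b n t ≤ C * p n t := fun n t ht =>
    (hJ _ (blk_posSemidef (hst t ht).posSemidef n)).2
  have hp' : ∀ n t, HasDerivAt (p n) (b (n - 1) t - b n t) t := by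
    intro n t
    have h := hasDerivAt_exp_smul_apply G ((traceCLM (Fin d)).comp (blk n n)) (emb k ρ) t
    have h2 := Complex.reCLM.hasFDerivAt.comp_hasDerivAt t h
    have h3 : (traceCLM (Fin d)).comp (blk n n) (G (NormedSpace.exp (t • G) (emb k ρ)))
        = (tickPart J (blk (n - 1) (n - 1) (Z t))).trace - (tickPart J (blk n n (Z t))).trace :=
      trace_blk_generator_periodic H L J n (hW t)
    rw [h3, map_sub] at h2
    exact h2
  -- `p (k + 1)` decays at most at rate `C`
  have hmono : ∀ s t, 0 ≤ s → s ≤ t → p (k + 1) s ≤ Real.exp (C * t) * p (k + 1) t := by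
    have hm : MonotoneOn (fun t => Real.exp (C * t) * p (k + 1) t) (Set.Ici 0) := by
      have hder : ∀ t, HasDerivAt (fun t => Real.exp (C * t) * p (k + 1) t)
          (Real.exp (C * t) * (C * p (k + 1) t + (b (k + 1 - 1) t - b (k + 1) t))) t := by
        intro t
        have h1 : HasDerivAt (fun t => Real.exp (C * t)) (Real.exp (C * t) * C) t := by
          simpa using ((hasDerivAt_id t).const_mul C).exp
        have h2 := h1.mul (hp' (k + 1) t)
        rw [mul_assoc, ← mul_add] at h2
        exact h2
      refine monotoneOn_of_deriv_nonneg (convex_Ici 0)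
        (fun t _ => (hder t).continuousAt.continuousWithinAt)
        (fun t _ => (hder t).differentiableAt.differentiableWithinAt) fun t ht => ?_
      rw [interior_Ici] at ht
      have ht : 0 ≤ t := le_of_lt ht
      rw [(hder t).deriv]
      have := hb0 (k + 1 - 1) t ht
      have := hbp (k + 1) t ht
      exact mul_nonneg (Real.exp_pos _).le (by linarith)
    intro s t hs hst
    refine le_trans ?_ (hm hs (hs.trans hst) hst)
    exact le_mul_of_one_le_left (hp0 _ s hs) (Real.one_le_exp (by positivity))
  -- the remaining weight is complementary to the weights at `k` and `k + 1`, so that it only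
  -- changes by ticks from `k + 1` and by ticks into `k`
  have hsum : ∀ t, 0 ≤ t → ∑ l ∈ Finset.univ.filter (fun l => l ≠ k ∧ l ≠ k + 1), p l t
      = 1 - p k t - p (k + 1) t := by
    intro t ht
    have h1 : ∑ l, p l t = 1 := (hst t ht).sum_re_trace_blk
    have h2 : Finset.univ.filter (fun l : Fin (N + 1) => l ≠ k ∧ l ≠ k + 1)
        = (Finset.univ.erase k).erase (k + 1) := by
      ext l; simp [and_comm]
    rw [h2, ← h1, ← Finset.add_sum_erase _ _ (Finset.mem_univ k), ← Finset.add_sum_erase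
      (Finset.univ.erase k) _ (Finset.mem_erase.2 ⟨hk, Finset.mem_univ (k + 1)⟩)]
    ring
  have hbound : ∀ t, 0 ≤ t → 1 - p k t - p (k + 1) t
      ≤ C * (Real.exp (C * t) * p (k + 1) t) * t := by
    intro t ht
    set K : ℝ := C * (Real.exp (C * t) * p (k + 1) t)
    have hder : ∀ s, HasDerivAt (fun s => K * s - (1 - p k s - p (k + 1) s))
        (K - (0 - (b (k - 1) s - b k s) - (b (k + 1 - 1) s - b (k + 1) s))) s := by
      intro s
      have h1 : HasDerivAt (fun s : ℝ => K * s) K s := by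
        simpa using (hasDerivAt_id s).const_mul K
      exact h1.sub (((hasDerivAt_const s (1 : ℝ)).sub (hp' k s)).sub (hp' (k + 1) s))
    have hm : MonotoneOn (fun s => K * s - (1 - p k s - p (k + 1) s)) (Set.Icc 0 t) := by
      refine monotoneOn_of_deriv_nonneg (convex_Icc 0 t)
        (fun s _ => (hder s).continuousAt.continuousWithinAt)
        (fun s _ => (hder s).differentiableAt.differentiableWithinAt) fun s hs => ?_
      rw [interior_Icc] at hs
      rw [(hder s).deriv, add_sub_cancel_right]
      have h1 := hb0 (k - 1) s hs.1.le
      have h2 := hbp (k + 1) s hs.1.le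
      have h3 : C * p (k + 1) s ≤ K :=
        mul_le_mul_of_nonneg_left (hmono s t hs.1.le hs.2.le) hC
      linarith
    have h := hm ⟨le_rfl, ht⟩ ⟨ht, le_rfl⟩ ht
    have hZ0 : Z 0 = emb k ρ :=
      congrArg (fun Φ : SuperOp (CR d N) => Φ (emb k ρ)) (exp_zero_smul G)
    have hk0 : p k 0 = 1 := by
      simp only [hp, hZ0, blk_diag_emb, if_true, hρ.trace_eq_one, Complex.one_re]
    have hk1 : p (k + 1) 0 = 0 := by
      simp only [hp, hZ0, blk_diag_emb, if_neg hk.symm, trace_zero, Complex.zero_re]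
    simp only [hk0, hk1] at h
    linarith
  have hcoef : (fun t : ℝ => C * Real.exp (C * t) * t) =o[𝓝[>] 0] (fun _ => (1 : ℝ)) := by
    rw [isLittleO_one_iff]
    have : Continuous fun t : ℝ => C * Real.exp (C * t) * t := by fun_prop
    simpa using (this.tendsto 0).mono_left nhdsWithin_le_nhds
  have hlo := hcoef.mul_isBigO (isBigO_refl (p (k + 1)) (𝓝[>] 0))
  simp only [one_mul] at hlo
  have hpt : (fun t => tickProb (lindbladSemigroup .periodic H L J) ρ k (k + 1) t)
      = p (k + 1) := funext fun t => tickProb_eq _ _ _ _ _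
  rw [hpt]
  refine IsBigO.trans_isLittleO (IsBigO.of_bound 1 ?_) hlo
  filter_upwards [self_mem_nhdsWithin] with t (ht : 0 < t)
  have h1 : ∑ l ∈ Finset.univ.filter (fun l => l ≠ k ∧ l ≠ k + 1),
      tickProb (lindbladSemigroup .periodic H L J) ρ k l t
      = ∑ l ∈ Finset.univ.filter (fun l => l ≠ k ∧ l ≠ k + 1), p l t :=
    Finset.sum_congr rfl fun l _ => tickProb_eq _ _ _ _ _
  rw [h1, Real.norm_of_nonneg (Finset.sum_nonneg fun l _ => hp0 l t ht.le), hsum t ht.le, one_mul]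
  refine (hbound t ht.le).trans ((le_of_eq ?_).trans (le_abs_self _))
  ring

theorem isPeriodicClockChannel_lindbladSemigroup (hd : 0 < d) (hN : 0 < N) {H : Op (Fin d)}
    (hH : H.IsHermitian) (L J : Fin m → Op (Fin d)) :
    IsPeriodicClockChannel (lindbladSemigroup .periodic H L J : ℝ → SuperOp (CR d N)) where
  isChannel _ ht := isChannel_lindbladSemigroup hd .periodic hH L J ht
  timeInvariance := timeInvariance_lindbladSemigroup H L J
  selfTiming := selfTiming_lindbladSemigroup .periodic H L J
  zerothOrder := zerothOrder_lindbladSemigroup .periodic H L J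
  leadingOrder := leadingOrder_lindbladSemigroup hd hN hH L J

theorem generator_cutOff_emb (H : Op (Fin d)) (L J : Fin m → Op (Fin d)) {k : Fin (N + 1)}
    (hk : k ≠ Fin.last N) (X : Op (Fin d)) :
    generator .cutOff H L J (emb k X) = generator .periodic H L J (emb k X) := by
  rw [generator_emb, generator_emb, tickWeight_of_ne_last _ hk, tickWeight_of_ne_last _ hk]

/-- Restoring the wrap-around tick in a cut-off Lindblad semigroup gives an underlying periodic
clock, because the generators agree on the inputs `k ≠ N`. -/
theorem isUnderlying_lindbladSemigroup (hd : 0 < d) (hN : 0 < N) {H : Op (Fin d)}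
    (hH : H.IsHermitian) (L J : Fin m → Op (Fin d)) :
    IsUnderlying (lindbladSemigroup .periodic H L J : ℝ → SuperOp (CR d N))
      (lindbladSemigroup .cutOff H L J) where
  isPeriodicClockChannel := isPeriodicClockChannel_lindbladSemigroup hd hN hH L J
  agree ρ _ k hk := by
    refine ((exp_smul_apply_isLittleO (generator .cutOff H L J) (emb k ρ)).sub
      (exp_smul_apply_isLittleO (generator .periodic H L J) (emb k ρ))).congr_left fun t => ?_
    rw [generator_cutOff_emb H L J hk]
    exact sub_sub_sub_cancel_right _ _ _ |>.trans (sub_sub_sub_cancel_right _ _ _)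

/-- The partial trace over the clockwork as a continuous linear map. -/
def ptraceCCLM (d N : ℕ) : Op (CR d N) →L[ℂ] Op (Fin (N + 1)) :=
  LinearMap.toContinuousLinearMap
    { toFun := ptraceC
      map_add' := fun X Y => by
        ext r s; simp only [ptraceC_apply, map_add, trace_add, Matrix.add_apply]
      map_smul' := fun c X => by
        ext r s; simp only [ptraceC_apply, map_smul, trace_smul, Matrix.smul_apply,
          RingHom.id_apply] }

theorem ptraceCCLM_apply (X : Op (CR d N)) : ptraceCCLM d N X = ptraceC X := rfl

theorem ptraceC_emb (k : Fin (N + 1)) (X : Op (Fin d)) :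
    ptraceC (emb k X) = X.trace • proj k := by
  ext r s
  rw [ptraceC_apply, blk_emb, Matrix.smul_apply, proj, Matrix.single_apply]
  split_ifs <;> simp

theorem isCutOffClockChannel_lindbladSemigroup (hd : 0 < d) (hN : 0 < N) {H : Op (Fin d)}
    (hH : H.IsHermitian) (L J : Fin m → Op (Fin d)) :
    IsCutOffClockChannel (lindbladSemigroup .cutOff H L J : ℝ → SuperOp (CR d N)) where
  isChannel _ ht := isChannel_lindbladSemigroup hd .cutOff hH L J ht
  selfTiming := selfTiming_lindbladSemigroup .cutOff H L J
  cutOff := by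
    refine ⟨⟨_, isUnderlying_lindbladSemigroup hd hN hH L J⟩, fun ρ hρ => ?_⟩
    have h := exp_smul_apply_isLittleO (generator .cutOff H L J : SuperOp (CR d N))
      (emb (Fin.last N) ρ)
    have h2 := ((ptraceCCLM d N).isBigO_comp _ _).trans_isLittleO h
    refine h2.congr_left fun t => ?_
    have h3 : ptraceCCLM d N (generator .cutOff H L J (emb (Fin.last N) ρ)) = 0 := by
      rw [generator_emb, tickWeight_cutOff_last, zero_smul, zero_smul, sub_zero, add_zero,
        ptraceCCLM_apply, ptraceC_emb, noTickPart, trace_lindbladian, zero_smul]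
    rw [map_sub, map_sub, (ptraceCCLM d N).map_smul_of_tower, h3, smul_zero, sub_zero,
      ptraceCCLM_apply, ptraceCCLM_apply, ptraceC_emb, hρ.trace_eq_one, one_smul]
    rfl

/-! ### Negative times are irrelevant -/

section Congruence

variable {M M' : ℝ → SuperOp (CR d N)}

theorem IsPeriodicClockChannel.congr (hM : IsPeriodicClockChannel M)
    (h : ∀ t, 0 ≤ t → M' t = M t) : IsPeriodicClockChannel M' where
  isChannel t ht := h t ht ▸ hM.isChannel t ht
  timeInvariance t ht ρ hρ l k k' := by
    simpa only [clockBlock_eq, h t ht] using hM.timeInvariance t ht ρ hρ l k k'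
  selfTiming s t hs ht := by
    rw [h _ (add_nonneg hs ht), h s hs, h t ht, hM.selfTiming s t hs ht]
  zerothOrder := by
    refine ⟨(h 0 le_rfl).trans hM.zerothOrder.1, hM.zerothOrder.2.congr' ?_⟩
    filter_upwards [self_mem_nhdsWithin] with t (ht : 0 < t)
    rw [h t ht.le]
  leadingOrder ρ hρ k := by
    refine (hM.leadingOrder ρ hρ k).congr' ?_ ?_ <;>
      filter_upwards [self_mem_nhdsWithin] with t (ht : 0 < t) <;>
      simp only [tickProb_eq, h t ht.le]

theorem IsUnderlying.congr {P : ℝ → SuperOp (CR d N)} (hM : IsUnderlying P M)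
    (h : ∀ t, 0 ≤ t → M' t = M t) : IsUnderlying P M' where
  isPeriodicClockChannel := hM.isPeriodicClockChannel
  agree ρ hρ k hk := by
    refine (hM.agree ρ hρ k hk).congr' ?_ EventuallyEq.rfl
    filter_upwards [self_mem_nhdsWithin] with t (ht : 0 < t)
    simp only [fromTick, h t ht.le]

theorem IsCutOffClockChannel.congr (hM : IsCutOffClockChannel M)
    (h : ∀ t, 0 ≤ t → M' t = M t) : IsCutOffClockChannel M' where
  isChannel t ht := h t ht ▸ hM.isChannel t ht
  selfTiming s t hs ht := by
    rw [h _ (add_nonneg hs ht), h s hs, h t ht, hM.selfTiming s t hs ht]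
  cutOff := by
    obtain ⟨⟨P, hP⟩, h2⟩ := hM.cutOff
    refine ⟨⟨P, hP.congr h⟩, fun ρ hρ => (h2 ρ hρ).congr' ?_ EventuallyEq.rfl⟩
    filter_upwards [self_mem_nhdsWithin] with t (ht : 0 < t)
    simp only [fromTick, h t ht.le]

theorem HasClassicalRegister.congr (hM : HasClassicalRegister M)
    (h : ∀ t, 0 ≤ t → M' t = M t) : HasClassicalRegister M' := by
  intro t ht ρ hρ k
  simpa only [fromTick, h t ht] using hM t ht ρ hρ k

end Congruence

/-- A family that is a Lindblad semigroup at nonnegative times is a ticking clock with a classical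
register. -/
theorem isTickingClock_of_eq_lindbladSemigroup (hd : 0 < d) (hN : 0 < N) (κ : RegisterKind)
    {ρ₀ : Op (CR d N)} (hρ₀ : IsState ρ₀) {M : ℝ → SuperOp (CR d N)} {H : Op (Fin d)}
    (hH : H.IsHermitian) (L J : Fin m → Op (Fin d))
    (hM : ∀ t, 0 ≤ t → M t = lindbladSemigroup κ H L J t) :
    IsTickingClock κ ρ₀ M ∧ HasClassicalRegister M := by
  refine ⟨⟨hρ₀, ?_⟩, (hasClassicalRegister_lindbladSemigroup hd κ hH L J).congr hM⟩
  cases κ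
  · exact (isPeriodicClockChannel_lindbladSemigroup hd hN hH L J).congr hM
  · exact (isCutOffClockChannel_lindbladSemigroup hd hN hH L J).congr hM

end

noncomputable section

variable {d N : ℕ}

/-! ### Choi matrices and conditional complete positivity -/

/-- The unnormalised maximally entangled vector. -/
def entangledVec (d : ℕ) : Fin d × Fin d → ℂ := fun p => if p.1 = p.2 then 1 else 0

/-- The Choi matrix of a superoperator `Φ`: the image of the maximally entangled operator under
`Φ ⊗ id`. Its entry at `(a, i), (b, j)` is `Φ(|i⟩⟨j|) a b`. -/
def choi (Φ : SuperOp (Fin d)) : Op (Fin d × Fin d) :=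
  ampliate Φ d (vecMulVec (entangledVec d) (star (entangledVec d)))

theorem choi_apply (Φ : SuperOp (Fin d)) (a b i j : Fin d) :
    choi Φ (a, i) (b, j) = Φ (Matrix.single i j 1) a b := by
  have : (of fun a b => vecMulVec (entangledVec d) (star (entangledVec d)) (a, i) (b, j))
      = Matrix.single i j (1 : ℂ) := by
    ext a b
    simp only [of_apply, vecMulVec_apply, entangledVec, Pi.star_apply, Matrix.single_apply,
      eq_comm (a := i), eq_comm (a := j), ite_and]
    split_ifs <;> simp
  change Φ (of fun a b => vecMulVec (entangledVec d) (star (entangledVec d)) (a, i) (b, j)) a b = _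
  rw [this]

theorem apply_eq_sum_choi (Φ : SuperOp (Fin d)) (X : Op (Fin d)) (a b : Fin d) :
    Φ X a b = ∑ i, ∑ j, choi Φ (a, i) (b, j) * X i j := by
  conv_lhs => rw [Matrix.matrix_eq_sum_single X]
  rw [map_sum, Matrix.sum_apply]
  refine Finset.sum_congr rfl fun i _ => ?_
  rw [map_sum, Matrix.sum_apply]
  refine Finset.sum_congr rfl fun j _ => ?_
  have : Matrix.single i j (X i j) = X i j • Matrix.single i j (1 : ℂ) := by
    rw [Matrix.smul_single, smul_eq_mul, mul_one]
  rw [this, map_smul, Matrix.smul_apply, choi_apply, smul_eq_mul, mul_comm]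

theorem IsCP.choi_posSemidef {Φ : SuperOp (Fin d)} (hΦ : IsCP Φ) : (choi Φ).PosSemidef :=
  hΦ d _ (posSemidef_vecMulVec_self_star _)

theorem IsCP.exists_kraus {Φ : SuperOp (Fin d)} (hΦ : IsCP Φ) :
    ∃ V : Fin (d * d) → Op (Fin d), ∀ X, Φ X = ∑ m, V m * X * (V m)ᴴ := by
  obtain ⟨V, hV⟩ := TickingClock.exists_kraus hΦ.choi_posSemidef
  refine ⟨V, fun X => ?_⟩
  ext a b
  rw [apply_eq_sum_choi, hV]

theorem entangledVec_dotProduct :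
    star (entangledVec d) ⬝ᵥ entangledVec d = d := by
  simp [dotProduct, entangledVec, Fintype.sum_prod_type, apply_ite (starRingEnd ℂ)]

/-- The derivative at the identity of a family of completely positive maps has the form
`X ↦ K X + X K† + ∑ V X V†`. Its Choi matrix `D` is positive semidefinite on the orthogonal
complement of the maximally entangled vector `ω`, and differs from its compression there by
`ψ ω† + ω ψ†` for a vector `ψ`, which is the vectorisation of `K`. -/
theorem exists_form_of_tendsto (hd : 0 < d) {F : ℝ → SuperOp (Fin d)} {Γ : SuperOp (Fin d)}
    (hF : ∀ t, 0 ≤ t → IsCP (F t))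
    (hlim : Tendsto (fun t : ℝ => t⁻¹ • (F t - 1)) (𝓝[>] 0) (𝓝 Γ)) :
    ∃ (K : Op (Fin d)) (V : Fin (d * d) → Op (Fin d)),
      ∀ X, Γ X = K * X + X * Kᴴ + ∑ m, V m * X * (V m)ᴴ := by
  have hd0 : (d : ℂ) ≠ 0 := by exact_mod_cast hd.ne'
  set ω : Fin d × Fin d → ℂ := entangledVec d with hω
  set Ω : Op (Fin d × Fin d) := vecMulVec ω (star ω) with hΩ
  set D : Op (Fin d × Fin d) := choi Γ with hD
  set Q : Op (Fin d × Fin d) := (d : ℂ)⁻¹ • Ω with hQ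
  set R : Op (Fin d × Fin d) := 1 - Q with hR
  have hΩH : Ωᴴ = Ω := (posSemidef_vecMulVec_self_star ω).isHermitian
  have hRH : Rᴴ = R := by
    rw [hR, hQ, conjTranspose_sub, conjTranspose_one, conjTranspose_smul, hΩH]
    simp
  have hΩΩ : Ω * Ω = (d : ℂ) • Ω := by
    rw [hΩ, vecMulVec_mul_vecMulVec, entangledVec_dotProduct]
    simp [vecMulVec_smul]
  have hRΩ : R * Ω = 0 := by
    rw [hR, hQ, sub_mul, one_mul, smul_mul_assoc, hΩΩ, smul_smul, inv_mul_cancel₀ hd0, one_smul,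
      sub_self]
  have hDlim : Tendsto (fun t : ℝ => t⁻¹ • (choi (F t) - Ω)) (𝓝[>] 0) (𝓝 D) :=
    ((continuous_ampliate d Ω).tendsto Γ).comp hlim
  have hDH : Dᴴ = D := by
    refine tendsto_nhds_unique (((continuous_id.matrix_conjTranspose.tendsto D).comp
      hDlim).congr' ?_) hDlim
    filter_upwards [self_mem_nhdsWithin] with t (ht : 0 < t)
    have : (choi (F t))ᴴ = choi (F t) := (hF t ht.le).choi_posSemidef.isHermitian
    simp only [Function.comp_apply, id_eq, conjTranspose_smul, conjTranspose_sub, this, hΩH,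
      star_trivial]
  have hRDR : (R * D * R).PosSemidef := by
    have hc : Continuous fun B : Op (Fin d × Fin d) => R * B * R :=
      (continuous_const.mul continuous_id).mul continuous_const
    refine posSemidef_of_tendsto ((hc.tendsto D).comp hDlim) ?_
    filter_upwards [self_mem_nhdsWithin] with t (ht : 0 < t)
    have h1 : R * (t⁻¹ • (choi (F t) - Ω)) * R = t⁻¹ • (R * choi (F t) * Rᴴ) := by
      rw [hRH, mul_smul_comm, smul_mul_assoc, mul_sub R, hRΩ, sub_zero]
    simp only [Function.comp_apply, h1]
    exact ((hF t ht.le).choi_posSemidef.mul_mul_conjTranspose_same R).smul (inv_nonneg.2 ht.le)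
  set c : ℂ := star ω ⬝ᵥ (D *ᵥ ω) with hc
  have hcstar : star c = c := by
    rw [hc, ← star_dotProduct, star_mulVec, hDH, ← dotProduct_mulVec]
  -- the term `-c/(2d²) ω` compensates half of `Q D Q`, which is counted twice in `D Q + Q D`
  set ψ : Fin d × Fin d → ℂ := (d : ℂ)⁻¹ • (D *ᵥ ω) - ((d : ℂ)⁻¹ ^ 2 * (c / 2)) • ω with hψ
  have hsplit : D = R * D * R + vecMulVec ψ (star ω) + vecMulVec ω (star ψ) := by
    have hDΩ : D * Ω = vecMulVec (D *ᵥ ω) (star ω) := by rw [hΩ, mul_vecMulVec]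
    have hΩD : Ω * D = vecMulVec ω (star (D *ᵥ ω)) := by
      rw [hΩ, vecMulVec_mul, star_mulVec, hDH]
    have hΩDΩ : Ω * D * Ω = c • Ω := by
      rw [Matrix.mul_assoc, hDΩ, hΩ, vecMulVec_mul_vecMulVec, ← hc, vecMulVec_smul]
    have h1 : vecMulVec ψ (star ω) = (d : ℂ)⁻¹ • (D * Ω) - ((d : ℂ)⁻¹ ^ 2 * (c / 2)) • Ω := by
      rw [hDΩ, hψ, sub_vecMulVec, smul_vecMulVec, smul_vecMulVec]
    have h2 : vecMulVec ω (star ψ) = (d : ℂ)⁻¹ • (Ω * D) - ((d : ℂ)⁻¹ ^ 2 * (c / 2)) • Ω := by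
      rw [hΩD, hψ, star_sub, star_smul, star_smul, vecMulVec_sub, vecMulVec_smul, vecMulVec_smul]
      congr 2
      · simp
      · simp only [star_mul', star_pow, star_inv₀, star_natCast, star_div₀, hcstar, star_ofNat]
    have h3 : R * D * R = D - (d : ℂ)⁻¹ • (Ω * D) - (d : ℂ)⁻¹ • (D * Ω)
        + ((d : ℂ)⁻¹ ^ 2 * c) • Ω := by
      have : (d : ℂ)⁻¹ • ((d : ℂ)⁻¹ • (Ω * D * Ω)) = ((d : ℂ)⁻¹ ^ 2 * c) • Ω := by
        rw [hΩDΩ, smul_smul, smul_smul]; congr 1; ring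
      rw [← this, hR, hQ, sub_mul, sub_mul, mul_sub, mul_sub]
      simp only [one_mul, mul_one, smul_mul_assoc, mul_smul_comm]
      rw [smul_comm]
      abel
    have h4 : ((d : ℂ)⁻¹ ^ 2 * c) • Ω = ((d : ℂ)⁻¹ ^ 2 * (c / 2)) • Ω
        + ((d : ℂ)⁻¹ ^ 2 * (c / 2)) • Ω := by
      rw [← add_smul]; congr 1; ring
    rw [h1, h2, h3, h4]
    abel
  obtain ⟨V, hV⟩ := TickingClock.exists_kraus hRDR
  refine ⟨of fun a i => ψ (a, i), V, fun X => ?_⟩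
  ext a b
  rw [apply_eq_sum_choi, ← hD, Matrix.add_apply, Matrix.add_apply, ← hV]
  have h1 : ∀ i j, D (a, i) (b, j) * X i j = (R * D * R) (a, i) (b, j) * X i j
      + (if b = j then ψ (a, i) * X i j else 0)
      + (if a = i then X i j * star (ψ (b, j)) else 0) := by
    intro i j
    conv_lhs => rw [hsplit]
    simp only [Matrix.add_apply, vecMulVec_apply, Pi.star_apply, hω, entangledVec, add_mul]
    split_ifs <;> simp [mul_comm]
  simp only [h1, Finset.sum_add_distrib, Finset.sum_ite_eq, Finset.mem_univ, if_true]
  have h2 : ∑ i, ∑ j, (if a = i then X i j * star (ψ (b, j)) else 0)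
      = ∑ j, X a j * star (ψ (b, j)) := by
    rw [Finset.sum_comm]
    simp
  rw [h2, mul_apply, mul_apply]
  simp only [of_apply, conjTranspose_apply]
  ring

/-! ### The generator of a clock with a periodic register -/

/-- The clockwork map that takes the register from `k` to `n`. -/
def blockMap (Φ : SuperOp (CR d N)) (k n : Fin (N + 1)) : SuperOp (Fin d) :=
  (blk n n).comp (Φ.comp (emb k))

theorem blockMap_apply (Φ : SuperOp (CR d N)) (k n : Fin (N + 1)) (X : Op (Fin d)) :
    blockMap Φ k n X = blk n n (Φ (emb k X)) := rfl

theorem IsCP.blockMap {Φ : SuperOp (CR d N)} (hΦ : IsCP Φ) (k n : Fin (N + 1)) :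
    IsCP (blockMap Φ k n) := by
  intro m X hX
  have h1 := (hX.kronecker (proj_posSemidef k)).submatrix
    (fun p : CR d N × Fin m => ((p.1.1, p.2), p.1.2))
  have h2 := (hΦ m _ h1).submatrix (fun p : Fin d × Fin m => ((p.1, n), p.2))
  exact h2

theorem continuous_blockMap (k n : Fin (N + 1)) :
    Continuous fun Φ : SuperOp (CR d N) => blockMap Φ k n :=
  (ContinuousLinearMap.compL ℂ _ _ _ (blk n n)).continuous.comp
    ((ContinuousLinearMap.compL ℂ (Op (Fin d)) (Op (CR d N)) (Op (CR d N))).flip (emb k)).continuous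

theorem tendsto_slope_exp {𝔸 : Type*} [NormedRing 𝔸] [NormedAlgebra ℝ 𝔸] [CompleteSpace 𝔸]
    (G : 𝔸) : Tendsto (fun t : ℝ => t⁻¹ • (NormedSpace.exp (t • G) - 1)) (𝓝[>] 0) (𝓝 G) := by
  have h := (hasDerivAt_exp_smul G 0).tendsto_slope_zero_right
  simpa using h

section Periodic

variable {P : ℝ → SuperOp (CR d N)}

theorem SelfTiming.map_add (h : SelfTiming P) (s t : ℝ) (hs : 0 ≤ s) (ht : 0 ≤ t) :
    P (s + t) = P s * P t := by
  rw [add_comm s t]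
  exact h t s ht hs

theorem IsPeriodicClockChannel.exists_generator (hP : IsPeriodicClockChannel P) :
    ∃ G : SuperOp (CR d N), (∀ t, 0 ≤ t → P t = NormedSpace.exp (t • G)) ∧
      Tendsto (fun t : ℝ => t⁻¹ • (P t - 1)) (𝓝[>] 0) (𝓝 G) := by
  have hlim : Tendsto P (𝓝[>] 0) (𝓝 1) := tendsto_iff_norm_sub_tendsto_zero.2 hP.zerothOrder.2
  obtain ⟨G, hG⟩ := TickingClock.exists_generator (T := P) hP.selfTiming.map_add hlim
  refine ⟨G, hG, (tendsto_slope_exp G).congr' ?_⟩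
  filter_upwards [self_mem_nhdsWithin] with t (ht : 0 < t)
  rw [hG t ht.le]

variable {G : SuperOp (CR d N)}

theorem tendsto_slope_blockMap (hG : Tendsto (fun t : ℝ => t⁻¹ • (P t - 1)) (𝓝[>] 0) (𝓝 G))
    (k n : Fin (N + 1)) :
    Tendsto (fun t : ℝ => t⁻¹ • (blockMap (P t) k n - if k = n then 1 else 0)) (𝓝[>] 0)
      (𝓝 (blockMap G k n)) := by
  have h1 : blockMap (1 : SuperOp (CR d N)) k n = if k = n then 1 else 0 := by
    ext1 X
    rw [blockMap_apply]
    change blk n n (emb k X) = _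
    rw [blk_diag_emb]
    split_ifs <;> rfl
  rw [← h1]
  refine (((continuous_blockMap k n).tendsto G).comp hG).congr fun t => ?_
  ext1 X
  change blk n n (t⁻¹ • (P t (emb k X) - emb k X)) = t⁻¹ • (blk n n (P t (emb k X)) -
    blk n n (emb k X))
  rw [(blk n n).map_smul_of_tower, map_sub]

theorem IsPeriodicClockChannel.isCP_blockMap (hP : IsPeriodicClockChannel P)
    (hG : Tendsto (fun t : ℝ => t⁻¹ • (P t - 1)) (𝓝[>] 0) (𝓝 G)) {k n : Fin (N + 1)}
    (hkn : k ≠ n) : IsCP (blockMap G k n) := by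
  refine IsCP.of_tendsto (tendsto_slope_blockMap hG k n) ?_
  filter_upwards [self_mem_nhdsWithin] with t (ht : 0 < t)
  rw [if_neg hkn, sub_zero]
  exact (IsCP.blockMap (hP.isChannel t ht.le).completelyPositive k n).smul (inv_nonneg.2 ht.le)

theorem IsPeriodicClockChannel.blockMap_translate (hP : IsPeriodicClockChannel P)
    (hG : Tendsto (fun t : ℝ => t⁻¹ • (P t - 1)) (𝓝[>] 0) (𝓝 G)) (k k' l : Fin (N + 1)) :
    blockMap G k (k + l) = blockMap G k' (k' + l) := by
  refine tendsto_nhds_unique ((tendsto_slope_blockMap hG k (k + l)).congr' ?_)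
    (tendsto_slope_blockMap hG k' (k' + l))
  filter_upwards [self_mem_nhdsWithin] with t (ht : 0 < t)
  have h1 : blockMap (P t) k (k + l) = blockMap (P t) k' (k' + l) := by
    ext1 X
    refine linearMap_eq_of_states (f := (blockMap (P t) k (k + l)).toLinearMap)
      (g := (blockMap (P t) k' (k' + l)).toLinearMap) (fun ρ hρ => ?_) X
    have := hP.timeInvariance t ht.le ρ hρ l k k'
    rwa [clockBlock_eq, clockBlock_eq] at this
  simp only [h1, left_eq_add]

theorem tendsto_slope_tickProb (hG : Tendsto (fun t : ℝ => t⁻¹ • (P t - 1)) (𝓝[>] 0) (𝓝 G))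
    (ρ : Op (Fin d)) {k n : Fin (N + 1)} (hkn : k ≠ n) :
    Tendsto (fun t : ℝ => t⁻¹ * tickProb P ρ k n t) (𝓝[>] 0)
      (𝓝 (blockMap G k n ρ).trace.re) := by
  have h := tendsto_slope_blockMap hG k n
  simp only [if_neg hkn, sub_zero] at h
  have hc : Continuous fun Φ : SuperOp (Fin d) => (Φ ρ).trace.re :=
    Complex.continuous_re.comp ((traceCLM (Fin d)).continuous.comp
      (ContinuousLinearMap.apply ℂ (Op (Fin d)) ρ).continuous)
  refine ((hc.tendsto _).comp h).congr fun t => ?_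
  rw [tickProb_eq]
  change (t⁻¹ • blk n n (P t (emb k ρ))).trace.re = _
  rw [trace_smul, Complex.smul_re, smul_eq_mul]

/-- By the leading-order condition, the generator only involves transitions `k → k` and
`k → k + 1` of the register. -/
theorem IsPeriodicClockChannel.blockMap_eq_zero (hN : 0 < N) (hP : IsPeriodicClockChannel P)
    (hG : Tendsto (fun t : ℝ => t⁻¹ • (P t - 1)) (𝓝[>] 0) (𝓝 G)) {k n : Fin (N + 1)}
    (hkn : n ≠ k) (hkn' : n ≠ k + 1) : blockMap G k n = 0 := by
  have hk : k ≠ k + 1 := by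
    have : NeZero N := ⟨hN.ne'⟩
    simp
  ext1 X
  refine linearMap_eq_of_states (f := (blockMap G k n).toLinearMap)
      (g := 0) (fun ρ hρ => ?_) X
  have hpos : ((blockMap G k n) ρ).PosSemidef :=
    (hP.isCP_blockMap hG hkn.symm).posSemidef hρ.posSemidef
  refine posSemidef_eq_zero_of_re_trace hpos ?_
  have hnn : ∀ l t, 0 ≤ t → 0 ≤ tickProb P ρ k l t := fun l t ht => by
    rw [tickProb_eq]
    exact ((hP.isChannel t ht).isState (hρ.emb k)).re_trace_blk_nonneg l
  have hO : (fun t => tickProb P ρ k (k + 1) t) =O[𝓝[>] 0] (fun t : ℝ => t) := by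
    have h := (tendsto_slope_tickProb hG ρ hk).isBigO_one ℝ
    refine ((isBigO_refl (fun t : ℝ => t) _).mul h).congr' ?_ (by simp)
    filter_upwards [self_mem_nhdsWithin] with t (ht : 0 < t)
    rw [mul_inv_cancel_left₀ ht.ne']
  have ho : (fun t => tickProb P ρ k n t) =o[𝓝[>] 0] (fun t : ℝ => t) := by
    refine (IsBigO.of_bound 1 ?_).trans_isLittleO ((hP.leadingOrder ρ hρ k).trans_isBigO hO)
    filter_upwards [self_mem_nhdsWithin] with t (ht : 0 < t)
    rw [one_mul, Real.norm_of_nonneg (hnn n t ht.le), Real.norm_of_nonneg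
      (Finset.sum_nonneg fun l _ => hnn l t ht.le)]
    exact Finset.single_le_sum (f := fun l => tickProb P ρ k l t) (fun l _ => hnn l t ht.le)
      (by simp [hkn, hkn'])
  refine tendsto_nhds_unique (tendsto_slope_tickProb hG ρ hkn.symm) ?_
  refine ho.tendsto_div_nhds_zero.congr fun t => ?_
  rw [div_eq_inv_mul]

theorem IsPeriodicClockChannel.trace_generator (hP : IsPeriodicClockChannel P)
    (hG : Tendsto (fun t : ℝ => t⁻¹ • (P t - 1)) (𝓝[>] 0) (𝓝 G)) (X : Op (CR d N)) :
    (G X).trace = 0 := by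
  have hc : Continuous fun Φ : SuperOp (CR d N) => (Φ X).trace :=
    (traceCLM (CR d N)).continuous.comp
      (ContinuousLinearMap.apply ℂ (Op (CR d N)) X).continuous
  refine tendsto_nhds_unique ((hc.tendsto G).comp hG) (tendsto_const_nhds.congr' ?_)
  filter_upwards [self_mem_nhdsWithin] with t (ht : 0 < t)
  change 0 = (t⁻¹ • (P t X - X)).trace
  rw [trace_smul, trace_sub, (hP.isChannel t ht.le).tracePreserving, sub_self, smul_zero]

theorem eq_zero_of_forall_trace_mul {S : Op (Fin d)} (h : ∀ X : Op (Fin d), (S * X).trace = 0) :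
    S = 0 := by
  have := h Sᴴ
  rwa [trace_mul_conjTranspose_self_eq_zero_iff] at this

/-- The register-diagonal blocks of the generator of a periodic clock are those of a Lindblad
generator of tick type. The clock itself need not have a classical register. -/
theorem IsPeriodicClockChannel.exists_lindblad_form (hd : 0 < d) (hN : 0 < N)
    (hP : IsPeriodicClockChannel P)
    (hG : Tendsto (fun t : ℝ => t⁻¹ • (P t - 1)) (𝓝[>] 0) (𝓝 G)) :
    ∃ (H : Op (Fin d)) (L J : Fin (d * d) → Op (Fin d)), H.IsHermitian ∧
      ∀ (k n : Fin (N + 1)) (X : Op (Fin d)),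
        blk n n (G (emb k X)) = blk n n (generator .periodic H L J (emb k X)) := by
  have hk : ∀ k : Fin (N + 1), k ≠ k + 1 := fun k => by
    have : NeZero N := ⟨hN.ne'⟩
    simp
  obtain ⟨K, L, hKL⟩ : ∃ (K : Op (Fin d)) (V : Fin (d * d) → Op (Fin d)),
      ∀ X, blockMap G 0 0 X = K * X + X * Kᴴ + ∑ m, V m * X * (V m)ᴴ := by
    refine exists_form_of_tendsto hd (F := fun t => blockMap (P t) 0 0)
      (fun t ht => IsCP.blockMap (hP.isChannel t ht).completelyPositive 0 0) ?_
    simpa using tendsto_slope_blockMap hG 0 0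
  obtain ⟨J, hJ⟩ := (hP.isCP_blockMap hG (hk 0)).exists_kraus
  set S : Op (Fin d) := ∑ m, (L m)ᴴ * L m + ∑ m, (J m)ᴴ * J m with hS
  -- trace preservation determines the Hermitian part of `K`
  have hKK : K + Kᴴ = -S := by
    rw [← add_eq_zero_iff_eq_neg]
    refine eq_zero_of_forall_trace_mul fun X => ?_
    have h1 : (G (emb 0 X)).trace = (blockMap G 0 0 X).trace + (blockMap G 0 (0 + 1) X).trace := by
      rw [trace_eq_sum_blk, Finset.sum_eq_add (0 : Fin (N + 1)) (0 + 1) (hk 0)]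
      · rfl
      · rintro n - ⟨h1, h2⟩
        rw [← blockMap_apply, hP.blockMap_eq_zero hN hG h1 h2]
        exact trace_zero _ _
      · simp
      · simp
    rw [hP.trace_generator hG, hKL, hJ] at h1
    rw [h1]
    have hcyc : ∀ V : Op (Fin d), (V * X * Vᴴ).trace = (Vᴴ * V * X).trace := fun V => by
      rw [Matrix.trace_mul_comm, Matrix.mul_assoc]
    simp only [hS, add_mul, Finset.sum_mul, trace_add, trace_sum, hcyc, trace_mul_comm X]
    ring
  refine ⟨(Complex.I / 2) • (K - Kᴴ), L, J, ?_, ?_⟩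
  · rw [IsHermitian, conjTranspose_smul, conjTranspose_sub, conjTranspose_conjTranspose]
    have : star (Complex.I / 2) = -(Complex.I / 2) := by simp [neg_div]
    rw [this, neg_smul, ← smul_neg, neg_sub]
  -- the anti-Hermitian part of `K` is `-i H`, its Hermitian part is `-½ (∑ L† L + ∑ J† J)`
  have hdiag : ∀ X, blockMap G 0 0 X
      = noTickPart ((Complex.I / 2) • (K - Kᴴ)) L X - lossPart J X := by
    intro X
    have hI : (-Complex.I) * (Complex.I / 2) = 1 / 2 := by
      rw [neg_mul, mul_div_assoc', Complex.I_mul_I, neg_div, neg_neg]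
    have hham : hamiltonianPart ((Complex.I / 2) • (K - Kᴴ)) X
        = (1 / 2 : ℂ) • ((K - Kᴴ) * X - X * (K - Kᴴ)) := by
      rw [hamiltonianPart_apply, smul_mul_assoc, mul_smul_comm, ← smul_sub, smul_smul, hI]
    have hloss : ∑ m, (1 / 2 : ℂ) • ((L m)ᴴ * L m * X + X * ((L m)ᴴ * L m))
        + ∑ m, (1 / 2 : ℂ) • ((J m)ᴴ * J m * X + X * ((J m)ᴴ * J m))
        = (1 / 2 : ℂ) • (S * X + X * S) := by
      simp only [hS, ← Finset.smul_sum, Finset.sum_add_distrib, add_mul, mul_add,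
        Finset.sum_mul, Finset.mul_sum, smul_add]
      abel
    have hSK : S = -(K + Kᴴ) := by rw [hKK, neg_neg]
    have hhalf : K * X + X * Kᴴ = (1 / 2 : ℂ) • ((K - Kᴴ) * X - X * (K - Kᴴ))
        - (1 / 2 : ℂ) • (S * X + X * S) := by
      have h2 : ∀ Y : Op (Fin d), Y = (1 / 2 : ℂ) • Y + (1 / 2 : ℂ) • Y := fun Y => by
        rw [← add_smul]; norm_num
      rw [hSK, ← smul_sub]
      conv_lhs => rw [h2 (K * X + X * Kᴴ), ← smul_add]
      congr 1
      noncomm_ring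
    rw [hKL, noTickPart, lindbladian_apply, lossPart_apply, hham, hhalf, ← hloss]
    simp only [dissipator_apply, Finset.sum_sub_distrib]
    abel
  intro k n X
  rw [generator_emb, tickWeight_periodic, one_smul, one_smul, map_add, blk_diag_emb, blk_diag_emb,
    ← hdiag, ← blockMap_apply, tickPart_apply, ← hJ]
  by_cases h1 : k = n
  · subst h1
    rw [if_pos rfl, if_neg (hk k).symm, add_zero]
    have := hP.blockMap_translate hG k 0 0
    rw [add_zero, add_zero] at this
    rw [this]
  · by_cases h2 : k + 1 = n
    · subst h2
      rw [if_neg h1, if_pos rfl, zero_add, hP.blockMap_translate hG k 0 1]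
    · rw [if_neg h1, if_neg h2, add_zero,
        hP.blockMap_eq_zero hN hG (fun h => h1 h.symm) (fun h => h2 h.symm)]
      rfl

/-- For a classical register, the generator of a periodic clock agrees with a Lindblad generator of
tick type on block-diagonal operators, and so do the exponentials. -/
theorem IsPeriodicClockChannel.exists_sameDynamics (hd : 0 < d) (hN : 0 < N)
    (hP : IsPeriodicClockChannel P) (hcl : HasClassicalRegister P) :
    ∃ (H : Op (Fin d)) (L J : Fin (d * d) → Op (Fin d)), H.IsHermitian ∧
      SameDynamics .periodic P (lindbladSemigroup .periodic H L J) := by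
  obtain ⟨G, hexp, hG⟩ := hP.exists_generator
  obtain ⟨H, L, J, hH, hblk⟩ := hP.exists_lindblad_form hd hN hG
  have hW : ∀ k X, G (emb k X) ∈ blockDiag d N := by
    intro k X
    have hc : Tendsto (fun t : ℝ => (t⁻¹ • (P t - 1)) (emb k X)) (𝓝[>] 0) (𝓝 (G (emb k X))) :=
      ((ContinuousLinearMap.apply ℂ (Op (CR d N)) (emb k X)).continuous.tendsto G).comp hG
    refine isClosed_blockDiag.mem_of_tendsto hc ?_
    filter_upwards [self_mem_nhdsWithin] with t (ht : 0 < t)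
    exact (blockDiag d N).smul_of_tower_mem t⁻¹
      (Submodule.sub_mem _ (hcl.mem_blockDiag ht.le k X) (emb_mem_blockDiag k X))
  have hEq : ∀ k X, G (emb k X) = generator .periodic H L J (emb k X) := fun k X =>
    eq_of_mem_blockDiag (hW k X) (generator_mem_blockDiag _ _ _ _ (emb_mem_blockDiag k X))
      fun n => hblk k n X
  have hEqW : ∀ Y ∈ blockDiag d N, G Y = generator .periodic H L J Y := by
    intro Y hY
    rw [eq_sum_emb hY, map_sum, map_sum]
    exact Finset.sum_congr rfl fun n _ => hEq n _
  refine ⟨H, L, J, hH, fun t ht k X => ?_⟩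
  change P t (emb k X) = _
  rw [hexp t ht]
  exact exp_smul_intertwine (G' := generator .periodic H L J)
    (ContinuousLinearMap.id ℂ (Op (CR d N)))
    (fun Y hY => hEqW Y hY ▸ generator_mem_blockDiag _ H L J hY) hEqW t (emb_mem_blockDiag k X)

end Periodic

end

noncomputable section

variable {d N : ℕ}

/-! ### Clocks with a cut-off register -/

section CutOff

variable {M : ℝ → SuperOp (CR d N)}

/-- The weight that leaves the register state `|N⟩` up to time `t`, as a functional of the
clockwork input. -/
def leak (M : ℝ → SuperOp (CR d N)) (t : ℝ) : Op (Fin d) →L[ℂ] ℂ :=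
  traceCLM (Fin d) - (traceCLM (Fin d)).comp (blockMap (M t) (Fin.last N) (Fin.last N))

theorem leak_apply (t : ℝ) (X : Op (Fin d)) :
    leak M t X = X.trace - (blk (Fin.last N) (Fin.last N) (M t (emb (Fin.last N) X))).trace := rfl

theorem IsCutOffClockChannel.leak_isLittleO (hM : IsCutOffClockChannel M) :
    (fun t => leak M t) =o[𝓝[>] 0] (fun t : ℝ => t) := by
  refine norm_isLittleO_of_forall fun X => ?_
  refine isLittleO_of_states (f := fun t => (leak M t).toLinearMap) (fun ρ hρ => ?_) X
  have h := hM.cutOff.2 ρ hρ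
  have hb : (fun t => leak M t ρ) =O[𝓝[>] 0]
      (fun t => ptraceC (fromTick M t (Fin.last N) ρ) - proj (Fin.last N)) := by
    refine (((LinearMap.toContinuousLinearMap (Matrix.entryLinearMap ℂ ℂ (Fin.last N)
      (Fin.last N)) : Op (Fin (N + 1)) →L[ℂ] ℂ).isBigO_comp _ _).neg_left).congr_left fun t => ?_
    rw [leak_apply, hρ.trace_eq_one]
    change -(ptraceC (fromTick M t (Fin.last N) ρ) (Fin.last N) (Fin.last N)
      - proj (Fin.last N) (Fin.last N) (Fin.last N)) = _
    rw [ptraceC_apply, proj, Matrix.single_apply, if_pos ⟨rfl, rfl⟩, neg_sub]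
    rfl
  exact hb.trans_isLittleO h

/-- The weight that leaves `|N⟩` is subadditive in time, up to a constant, so that it vanishes
because it is of second order for short times. -/
theorem IsCutOffClockChannel.re_leak_eq_zero (hM : IsCutOffClockChannel M)
    (hcl : HasClassicalRegister M) {ρ : Op (Fin d)} (hρ : IsState ρ) {t : ℝ} (ht : 0 < t) :
    (leak M t ρ).re = 0 := by
  obtain ⟨C, hC, hCn⟩ := exists_norm_le_mul_trace (ι := Fin d)
  have hst : ∀ t, 0 ≤ t → IsState (M t (emb (Fin.last N) ρ)) := fun t ht =>
    (hM.isChannel t ht).isState (hρ.emb _)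
  have hnn : ∀ t, 0 ≤ t → 0 ≤ (leak M t ρ).re := by
    intro t ht
    rw [leak_apply, hρ.trace_eq_one, Complex.sub_re, Complex.one_re, sub_nonneg]
    exact ((hst t ht).isSubState_blk _).trace_le_one
  have hle : ∀ s, ∀ Y : Op (Fin d), IsSubState Y → (leak M s Y).re ≤ C * ‖leak M s‖ := by
    intro s Y hY
    calc (leak M s Y).re ≤ ‖leak M s Y‖ := Complex.re_le_norm _
      _ ≤ ‖leak M s‖ * ‖Y‖ := (leak M s).le_opNorm Y
      _ ≤ ‖leak M s‖ * C := by
          gcongr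
          exact (hCn Y hY.posSemidef).trans (mul_le_of_le_one_right hC hY.trace_le_one)
      _ = _ := mul_comm _ _
  -- weight outside `N` at time `t + s` was either outside at time `t`, or left `N` afterwards
  have hadd : ∀ s t, 0 ≤ s → 0 ≤ t →
      (leak M (t + s) ρ).re ≤ (leak M t ρ).re + C * ‖leak M s‖ := by
    intro s t hs ht
    set Y := M t (emb (Fin.last N) ρ) with hY
    have hYW : Y ∈ blockDiag d N := hcl.mem_blockDiag ht _ ρ
    have h1 : M (t + s) (emb (Fin.last N) ρ) = M s Y := by
      rw [hM.selfTiming t s ht hs]; rfl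
    have h2 : (blk (Fin.last N) (Fin.last N) (M s Y)).trace.re
        = ∑ n, (blk (Fin.last N) (Fin.last N) (M s (emb n (blk n n Y)))).trace.re := by
      conv_lhs => rw [eq_sum_emb hYW]
      rw [map_sum, map_sum, trace_sum, Complex.re_sum]
    have h3 : (blk (Fin.last N) (Fin.last N)
        (M s (emb (Fin.last N) (blk (Fin.last N) (Fin.last N) Y)))).trace.re
        ≤ (blk (Fin.last N) (Fin.last N) (M s Y)).trace.re := by
      rw [h2]
      refine Finset.single_le_sum (f := fun n => (blk (Fin.last N) (Fin.last N)
        (M s (emb n (blk n n Y)))).trace.re) (fun n _ => ?_) (Finset.mem_univ _)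
      exact posSemidef_re_trace_nonneg (blk_posSemidef ((hM.isChannel s hs).posSemidef
        (emb_posSemidef (blk_posSemidef (hst t ht).posSemidef n) n)) _)
    have h4 := hle s _ ((hst t ht).isSubState_blk (Fin.last N))
    rw [leak_apply, Complex.sub_re] at h4
    rw [leak_apply, leak_apply, h1, Complex.sub_re, Complex.sub_re]
    linarith
  have hmul : ∀ (n : ℕ) (s : ℝ), 0 ≤ s →
      (leak M ((n + 1 : ℕ) * s) ρ).re ≤ (n + 1 : ℕ) * (C * ‖leak M s‖) := by
    intro n s hs
    induction n with
    | zero =>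
      simpa using hle s ρ ⟨hρ.posSemidef, by rw [hρ.trace_eq_one, Complex.one_re]⟩
    | succ n ih =>
      have h1 := hadd s ((n + 1 : ℕ) * s) hs (by positivity)
      have h2 : ((n + 1 : ℕ) : ℝ) * s + s = (n + 1 + 1 : ℕ) * s := by push_cast; ring
      rw [h2] at h1
      refine h1.trans ((add_le_add_left ih _).trans (le_of_eq ?_))
      push_cast
      ring
  refine le_antisymm ?_ (hnn t ht.le)
  have hs : Tendsto (fun n : ℕ => t / (n + 1 : ℕ)) atTop (𝓝[>] 0) := by
    refine tendsto_nhdsWithin_iff.2 ⟨?_, Eventually.of_forall fun n => ?_⟩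
    · exact (tendsto_const_div_atTop_nhds_zero_nat t).comp (tendsto_add_atTop_nat 1)
    · exact div_pos ht (by positivity)
  have hlim := ((hM.leak_isLittleO.norm_left.tendsto_div_nhds_zero).comp hs).const_mul (t * C)
  rw [mul_zero] at hlim
  refine ge_of_tendsto hlim (Eventually.of_forall fun n => ?_)
  have hn : ((n + 1 : ℕ) : ℝ) ≠ 0 := by positivity
  have h := hmul n (t / (n + 1 : ℕ)) (by positivity)
  rw [mul_div_cancel₀ _ hn] at h
  refine h.trans (le_of_eq ?_)
  simp only [Function.comp_apply]
  field_simp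

theorem IsCutOffClockChannel.blk_last_eq_zero_of_pos (hM : IsCutOffClockChannel M)
    (hcl : HasClassicalRegister M) {t : ℝ} (ht : 0 < t) {n : Fin (N + 1)} (hn : n ≠ Fin.last N)
    (X : Op (Fin d)) : blk n n (M t (emb (Fin.last N) X)) = 0 := by
  refine linearMap_eq_of_states (f := (blockMap (M t) (Fin.last N) n).toLinearMap) (g := 0)
    (fun ρ hρ => ?_) X
  have hst : IsState (M t (emb (Fin.last N) ρ)) := (hM.isChannel t ht.le).isState (hρ.emb _)
  refine posSemidef_eq_zero_of_re_trace (blk_posSemidef hst.posSemidef n) ?_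
  have h1 := hM.re_leak_eq_zero hcl hρ ht
  rw [leak_apply, hρ.trace_eq_one, Complex.sub_re, Complex.one_re, sub_eq_zero] at h1
  have h2 := hst.sum_re_trace_blk
  rw [← Finset.add_sum_erase _ _ (Finset.mem_univ (Fin.last N)), ← h1, add_eq_left,
    Finset.sum_eq_zero_iff_of_nonneg fun n _ => hst.re_trace_blk_nonneg n] at h2
  exact h2 n (Finset.mem_erase.2 ⟨hn, Finset.mem_univ n⟩)

/-- The family `M` has the first-order expansion `1 + t G` on the register states `k ≠ N`. -/
def HasFirstOrder (M : ℝ → SuperOp (CR d N)) (G : SuperOp (CR d N)) : Prop :=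
  ∀ k : Fin (N + 1), k ≠ Fin.last N → ∀ X : Op (Fin d),
    (fun t : ℝ => M t (emb k X) - emb k X - t • G (emb k X)) =o[𝓝[>] 0] (fun t : ℝ => t)

theorem tendsto_of_isLittleO {E : Type*} [NormedAddCommGroup E] [NormedSpace ℝ E] {f : ℝ → E}
    {a b : E} (h : (fun t : ℝ => f t - a - t • b) =o[𝓝[>] 0] (fun t : ℝ => t)) :
    Tendsto f (𝓝[>] 0) (𝓝 a) := by
  have hid : Tendsto (fun t : ℝ => t) (𝓝[>] 0) (𝓝 0) := tendsto_id.mono_left nhdsWithin_le_nhds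
  have h2 := ((h.trans_tendsto hid).add (hid.smul_const b)).add_const a
  rw [zero_smul, add_zero, zero_add] at h2
  refine h2.congr fun t => ?_
  abel

theorem HasFirstOrder.tendsto {G : SuperOp (CR d N)} (h : HasFirstOrder M G) {k : Fin (N + 1)}
    (hk : k ≠ Fin.last N) (X : Op (Fin d)) :
    Tendsto (fun t => M t (emb k X)) (𝓝[>] 0) (𝓝 (emb k X)) :=
  tendsto_of_isLittleO (h k hk X)

/-- The register state `|N⟩` is absorbing. -/
theorem IsCutOffClockChannel.blk_last_eq_zero (hM : IsCutOffClockChannel M)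
    (hcl : HasClassicalRegister M) {G : SuperOp (CR d N)} (hG : HasFirstOrder M G)
    {t : ℝ} (ht : 0 ≤ t) {n : Fin (N + 1)} (hn : n ≠ Fin.last N)
    (X : Op (Fin d)) : blk n n (M t (emb (Fin.last N) X)) = 0 := by
  rcases ht.eq_or_lt with rfl | ht
  · -- at time `0`, compare `M t = M t ∘ M 0` with the limit of `M t` on the output of `M 0`
    set Y := M 0 (emb (Fin.last N) X) with hY
    have hYW : Y ∈ blockDiag d N := hcl.mem_blockDiag le_rfl _ X
    have h0 : ∀ t, 0 < t → ∑ m, blk n n (M t (emb m (blk m m Y))) = 0 := by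
      intro t ht
      have h1 : M t (emb (Fin.last N) X) = M t Y := by
        conv_lhs => rw [← zero_add t, hM.selfTiming 0 t le_rfl ht.le]
        rfl
      rw [← hM.blk_last_eq_zero_of_pos hcl ht hn X, h1]
      conv_rhs => rw [eq_sum_emb hYW]
      rw [map_sum, map_sum]
    have hlim : Tendsto (fun t => ∑ m, blk n n (M t (emb m (blk m m Y)))) (𝓝[>] 0)
        (𝓝 (∑ m, if m = n then blk m m Y else 0)) := by
      refine tendsto_finsetSum _ fun m _ => ?_
      by_cases hm : m = Fin.last N
      · subst hm
        rw [if_neg hn.symm]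
        refine tendsto_const_nhds.congr' ?_
        filter_upwards [self_mem_nhdsWithin] with t (ht : 0 < t)
        rw [hM.blk_last_eq_zero_of_pos hcl ht hn]
      · rw [← blk_diag_emb]
        exact ((blk n n).continuous.tendsto _).comp (hG.tendsto hm _)
    rw [Finset.sum_ite_eq' Finset.univ n, if_pos (Finset.mem_univ n)] at hlim
    refine tendsto_nhds_unique hlim (tendsto_const_nhds.congr' ?_)
    filter_upwards [self_mem_nhdsWithin] with t (ht : 0 < t)
    rw [h0 t ht]
  · exact hM.blk_last_eq_zero_of_pos hcl ht hn X

/-- The projection onto the block-diagonal operators without weight on `|N⟩`. -/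
def cutProj (d N : ℕ) : SuperOp (CR d N) :=
  ∑ n ∈ Finset.univ.erase (Fin.last N), (emb n).comp (blk n n)

theorem cutProj_apply (X : Op (CR d N)) :
    cutProj d N X = ∑ n ∈ Finset.univ.erase (Fin.last N), emb n (blk n n X) := by
  simp [cutProj]

theorem cutProj_emb {k : Fin (N + 1)} (hk : k ≠ Fin.last N) (X : Op (Fin d)) :
    cutProj d N (emb k X) = emb k X := by
  rw [cutProj_apply, Finset.sum_eq_single k]
  · rw [blk_diag_emb, if_pos rfl]
  · intro n _ hn
    rw [blk_diag_emb, if_neg hn.symm, map_zero]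
  · intro h
    exact absurd (Finset.mem_erase.2 ⟨hk, Finset.mem_univ k⟩) h

theorem cutProj_mul_self : cutProj d N * cutProj d N = cutProj d N := by
  ext1 X
  rw [mul_apply_eq_comp]
  conv_lhs => rw [cutProj_apply X, map_sum]
  rw [cutProj_apply]
  exact Finset.sum_congr rfl fun n hn => cutProj_emb (Finset.ne_of_mem_erase hn) _

theorem blk_cutProj {n : Fin (N + 1)} (hn : n ≠ Fin.last N) (X : Op (CR d N)) :
    blk n n (cutProj d N X) = blk n n X := by
  rw [cutProj_apply, map_sum, Finset.sum_eq_single n]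
  · rw [blk_diag_emb, if_pos rfl]
  · intro m _ hm
    rw [blk_diag_emb, if_neg hm]
  · intro h
    exact absurd (Finset.mem_erase.2 ⟨hn, Finset.mem_univ n⟩) h

theorem eq_cutProj_add {X : Op (CR d N)} (hX : X ∈ blockDiag d N) :
    X = cutProj d N X + emb (Fin.last N) (blk (Fin.last N) (Fin.last N) X) := by
  conv_lhs => rw [eq_sum_emb hX]
  rw [cutProj_apply, Finset.sum_erase_add _ _ (Finset.mem_univ _)]

/-- The dynamics of a cut-off clock compressed to register states `n ≠ N`, extended by the identity
on a complement. -/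
def compressed (M : ℝ → SuperOp (CR d N)) (t : ℝ) : SuperOp (CR d N) :=
  1 + cutProj d N * (M t - 1) * cutProj d N

/-- Compression by an idempotent `p` respects the product `A * B` when `A` does not lead from the
kernel of `p` back to its range, on the outputs of `B * p`. -/
theorem one_add_compress_mul {𝔸 : Type*} [Ring 𝔸] {p A B : 𝔸} (hp : p * p = p)
    (h : p * A * B * p = p * A * p * B * p) :
    1 + p * (A * B - 1) * p = (1 + p * (A - 1) * p) * (1 + p * (B - 1) * p) := by
  have e1 : p * (A * B - 1) * p = p * A * p * B * p - p := by
    rw [← h]; simp only [mul_sub, sub_mul, mul_one, hp, mul_assoc]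
  have e2 : p * (A - 1) * p = p * A * p - p := by simp only [mul_sub, sub_mul, mul_one, hp]
  have e3 : p * (B - 1) * p = p * B * p - p := by simp only [mul_sub, sub_mul, mul_one, hp]
  have e4 : p * A * p * (p * B * p) = p * A * p * B * p := by
    rw [show p * A * p * (p * B * p) = p * A * (p * p) * B * p by simp only [mul_assoc], hp]
  have e5 : p * (p * B * p) = p * B * p := by
    rw [← mul_assoc, ← mul_assoc, hp]
  have e6 : p * A * p * p = p * A * p := by rw [mul_assoc, hp]
  have e7 : (p * A * p - p) * (p * B * p - p)
      = p * A * p * B * p - p * A * p - (p * B * p - p) := by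
    rw [sub_mul, mul_sub, mul_sub, e4, e5, e6, hp]
  rw [e1, e2, e3, add_mul, one_mul, mul_add, mul_one, e7]
  abel

theorem IsCutOffClockChannel.compressed_add (hM : IsCutOffClockChannel M)
    (hcl : HasClassicalRegister M) {G : SuperOp (CR d N)} (hG : HasFirstOrder M G) (s t : ℝ)
    (hs : 0 ≤ s) (ht : 0 ≤ t) : compressed M (s + t) = compressed M s * compressed M t := by
  rw [compressed, compressed, compressed, hM.selfTiming.map_add s t hs ht]
  refine one_add_compress_mul cutProj_mul_self ?_
  ext1 X
  simp only [mul_apply_eq_comp]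
  have hW : M t (cutProj d N X) ∈ blockDiag d N := by
    rw [cutProj_apply, map_sum]
    exact Submodule.sum_mem _ fun n _ => hcl.mem_blockDiag ht n _
  conv_lhs => rw [eq_cutProj_add hW]
  rw [map_add, map_add, add_eq_left, cutProj_apply]
  refine Finset.sum_eq_zero fun n hn => ?_
  rw [hM.blk_last_eq_zero hcl hG hs (Finset.ne_of_mem_erase hn), map_zero]

theorem one_add_compress_isLittleO {E : Type*} [NormedAddCommGroup E] [NormedSpace ℂ E]
    [FiniteDimensional ℂ E] {A : ℝ → E →L[ℂ] E} {p G : E →L[ℂ] E}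
    (h : ∀ x, (fun t : ℝ => A t (p x) - p x - t • G (p x)) =o[𝓝[>] 0] (fun t : ℝ => t)) :
    (fun t : ℝ => 1 + p * (A t - 1) * p - 1 - t • (p * G * p)) =o[𝓝[>] 0] (fun t : ℝ => t) := by
  refine norm_isLittleO_of_forall fun x => ?_
  refine ((p.isBigO_comp _ _).trans_isLittleO (h x)).congr_left fun t => ?_
  simp only [map_sub, p.map_smul_of_tower, add_sub_cancel_left, _root_.sub_apply,
    _root_.smul_apply, mul_apply_eq_comp, one_apply_eq_self]

theorem HasFirstOrder.compressed_isLittleO {G : SuperOp (CR d N)} (hG : HasFirstOrder M G) :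
    (fun t : ℝ => compressed M t - 1 - t • (cutProj d N * G * cutProj d N))
      =o[𝓝[>] 0] (fun t : ℝ => t) := by
  refine one_add_compress_isLittleO fun X => ?_
  have h1 : (fun t : ℝ => ∑ n ∈ Finset.univ.erase (Fin.last N), (M t (emb n (blk n n X))
      - emb n (blk n n X) - t • G (emb n (blk n n X)))) =o[𝓝[>] 0] (fun t : ℝ => t) :=
    IsLittleO.fun_sum fun n hn => hG n (Finset.ne_of_mem_erase hn) _
  refine h1.congr_left fun t => ?_
  simp only [cutProj_apply, Finset.sum_sub_distrib, map_sum, Finset.smul_sum]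

theorem HasFirstOrder.tendsto_compressed {G : SuperOp (CR d N)} (hG : HasFirstOrder M G) :
    Tendsto (compressed M) (𝓝[>] 0) (𝓝 1) :=
  tendsto_of_isLittleO (f := compressed M) (a := 1) (b := cutProj d N * G * cutProj d N)
    hG.compressed_isLittleO

/-- Cut-off clocks with a classical register are determined by their first-order expansions, except
for the state of the clockwork after the register has become full. -/
theorem IsCutOffClockChannel.blk_eq {M' : ℝ → SuperOp (CR d N)} (hM : IsCutOffClockChannel M)
    (hcl : HasClassicalRegister M) (hM' : IsCutOffClockChannel M')
    (hcl' : HasClassicalRegister M') {G : SuperOp (CR d N)} (hG : HasFirstOrder M G)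
    (hG' : HasFirstOrder M' G) {t : ℝ} (ht : 0 ≤ t) (k : Fin (N + 1)) {n : Fin (N + 1)}
    (hn : n ≠ Fin.last N) (X : Op (Fin d)) :
    blk n n (M t (emb k X)) = blk n n (M' t (emb k X)) := by
  by_cases hk : k = Fin.last N
  · rw [hk, hM.blk_last_eq_zero hcl hG ht hn, hM'.blk_last_eq_zero hcl' hG' ht hn]
  have h1 : compressed M t = compressed M' t := by
    refine semigroup_eq_of_isLittleO (T := compressed M) (T' := compressed M')
      (hM.compressed_add hcl hG) hG.tendsto_compressed
      (hM'.compressed_add hcl' hG') hG'.tendsto_compressed ?_ ht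
    refine (hG.compressed_isLittleO.sub hG'.compressed_isLittleO).congr_left fun t => ?_
    exact sub_sub_sub_cancel_right _ _ _ |>.trans (sub_sub_sub_cancel_right _ _ _)
  -- the blocks `n ≠ N` from inputs `k ≠ N` can be read off from the compression
  have h2 : ∀ M : ℝ → SuperOp (CR d N), blk n n (compressed M t (emb k X))
      = blk n n (M t (emb k X)) := by
    intro M
    change blk n n (emb k X + cutProj d N (M t (cutProj d N (emb k X))
      - cutProj d N (emb k X))) = _
    rw [map_add, blk_cutProj hn, map_sub, cutProj_emb hk, add_sub_cancel]
  rw [← h2 M, ← h2 M', h1]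

/-- A cut-off clock with a classical register has, up to clockwork equivalence, the dynamics of a
Lindblad semigroup: the underlying periodic clock provides the generator on the register states
`k ≠ N`. -/
theorem IsCutOffClockChannel.exists_sameDynamics (hd : 0 < d) (hN : 0 < N)
    (hM : IsCutOffClockChannel M) (hcl : HasClassicalRegister M) :
    ∃ (H : Op (Fin d)) (L J : Fin (d * d) → Op (Fin d)), H.IsHermitian ∧
      SameDynamics .cutOff M (lindbladSemigroup .cutOff H L J) := by
  obtain ⟨P, hP⟩ := hM.cutOff.1
  obtain ⟨G, hexp, hG⟩ := hP.isPeriodicClockChannel.exists_generator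
  obtain ⟨H, L, J, hH, hblk⟩ := hP.isPeriodicClockChannel.exists_lindblad_form hd hN hG
  have hfirst : HasFirstOrder M G := by
    intro k hk X
    have h1 : (fun t => M t (emb k X) - P t (emb k X)) =o[𝓝[>] 0] (fun t : ℝ => t) :=
      isLittleO_of_states (f := fun t => ((M t).comp (emb k) - (P t).comp (emb k)).toLinearMap)
        (fun ρ hρ => hP.agree ρ hρ k hk) X
    refine (h1.add (exp_smul_apply_isLittleO G (emb k X))).congr' ?_ EventuallyEq.rfl
    filter_upwards [self_mem_nhdsWithin] with t (ht : 0 < t)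
    rw [hexp t ht.le]
    abel
  have hEq : ∀ k, k ≠ Fin.last N → ∀ X : Op (Fin d),
      G (emb k X) = generator .cutOff H L J (emb k X) := by
    intro k hk X
    rw [generator_cutOff_emb H L J hk]
    refine eq_of_mem_blockDiag ?_ (generator_mem_blockDiag _ _ _ _ (emb_mem_blockDiag k X))
      fun n => hblk k n X
    have hlim : Tendsto (fun t : ℝ => t⁻¹ • (M t (emb k X) - emb k X)) (𝓝[>] 0)
        (𝓝 (G (emb k X))) := by
      have h1 : Tendsto (fun t : ℝ => t⁻¹ • (M t (emb k X) - emb k X - t • G (emb k X)))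
          (𝓝[>] 0) (𝓝 0) := by
        rw [tendsto_zero_iff_norm_tendsto_zero]
        refine ((hfirst k hk X).norm_left.norm_right.tendsto_div_nhds_zero).congr fun t => ?_
        rw [norm_smul, norm_inv, div_eq_inv_mul]
      have h2 := h1.add_const (G (emb k X))
      rw [zero_add] at h2
      refine h2.congr' ?_
      filter_upwards [self_mem_nhdsWithin] with t (ht : 0 < t)
      rw [smul_sub, smul_smul, inv_mul_cancel₀ ht.ne', one_smul, sub_add_cancel]
    refine isClosed_blockDiag.mem_of_tendsto hlim ?_
    filter_upwards [self_mem_nhdsWithin] with t (ht : 0 < t)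
    exact (blockDiag d N).smul_of_tower_mem t⁻¹
      (Submodule.sub_mem _ (hcl.mem_blockDiag ht.le k X) (emb_mem_blockDiag k X))
  set M' : ℝ → SuperOp (CR d N) := lindbladSemigroup .cutOff H L J with hM'def
  have hM' : IsCutOffClockChannel M' := isCutOffClockChannel_lindbladSemigroup hd hN hH L J
  have hcl' : HasClassicalRegister M' := hasClassicalRegister_lindbladSemigroup hd _ hH L J
  have hfirstC : HasFirstOrder M (generator .cutOff H L J) := fun k hk X => by
    have := hfirst k hk X
    rwa [hEq k hk X] at this
  have hfirst' : HasFirstOrder M' (generator .cutOff H L J) := fun k _ X =>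
    exp_smul_apply_isLittleO (generator .cutOff H L J) (emb k X)
  refine ⟨H, L, J, hH, ⟨lindbladSemigroup .periodic H L J, ?_, isUnderlying_lindbladSemigroup hd hN
    hH L J⟩, fun t ht k X => ?_⟩
  · refine ⟨isPeriodicClockChannel_lindbladSemigroup hd hN hH L J, fun ρ _ k hk => ?_⟩
    refine ((hfirstC k hk ρ).sub
      (exp_smul_apply_isLittleO (generator .periodic H L J) (emb k ρ))).congr_left fun t => ?_
    rw [generator_cutOff_emb H L J hk]
    exact sub_sub_sub_cancel_right _ _ _ |>.trans (sub_sub_sub_cancel_right _ _ _)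
  · have hb : ∀ n, n ≠ Fin.last N → blk n n (M t (emb k X)) = blk n n (M' t (emb k X)) :=
      fun n hn => hM.blk_eq hcl hM' hcl' hfirstC hfirst' ht k hn X
    refine ⟨fun n hn => ?_, ?_⟩
    · rw [clockBlock_eq, clockBlock_eq]
      exact hb n hn
    · -- the register populations sum to the trace of `X`, which fixes the one at `N`
      have htr : ∑ n, (blk n n (M t (emb k X))).trace = ∑ n, (blk n n (M' t (emb k X))).trace := by
        rw [← trace_eq_sum_blk, ← trace_eq_sum_blk, (hM.isChannel t ht).tracePreserving,
          (hM'.isChannel t ht).tracePreserving]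
      have hlast : (blk (Fin.last N) (Fin.last N) (M t (emb k X))).trace
          = (blk (Fin.last N) (Fin.last N) (M' t (emb k X))).trace := by
        rw [← Finset.sum_erase_add _ _ (Finset.mem_univ (Fin.last N)),
          ← Finset.sum_erase_add _ _ (Finset.mem_univ (Fin.last N)),
          Finset.sum_congr rfl fun n hn => by rw [hb n (Finset.ne_of_mem_erase hn)]] at htr
        exact add_left_cancel htr
      ext r s
      change (blk r s (M t (emb k X))).trace = (blk r s (M' t (emb k X))).trace
      by_cases hrs : r = s
      · subst hrs
        by_cases hr : r = Fin.last N
        · rw [hr, hlast]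
        · rw [hb r hr]
      · rw [hcl.mem_blockDiag ht k X r s hrs, hcl'.mem_blockDiag ht k X r s hrs]

end CutOff

end

end TickingClock

theorem mainTheorem1 (d N : ℕ) (hd : 0 < d) (hN : 0 < N) (κ : TickingClock.RegisterKind)
    (ρ₀ : TickingClock.Op (TickingClock.CR d N)) (hρ₀ : TickingClock.IsState ρ₀)
    (M : ℝ → TickingClock.SuperOp (TickingClock.CR d N)) :
    ((∃ (m : ℕ) (H : TickingClock.Op (Fin d)) (L J : Fin m → TickingClock.Op (Fin d)),
        H.IsHermitian ∧
          ∀ t : ℝ, 0 ≤ t → M t = TickingClock.lindbladSemigroup κ H L J t) →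
      TickingClock.IsTickingClock κ ρ₀ M ∧ TickingClock.HasClassicalRegister M) ∧
    (TickingClock.IsTickingClock κ ρ₀ M ∧ TickingClock.HasClassicalRegister M →
      ∃ (m : ℕ) (H : TickingClock.Op (Fin d)) (L J : Fin m → TickingClock.Op (Fin d)),
        H.IsHermitian ∧
          TickingClock.SameDynamics κ M (TickingClock.lindbladSemigroup κ H L J)) := by
  refine ⟨?_, ?_⟩
  · rintro ⟨m, H, L, J, hH, hM⟩
    exact TickingClock.isTickingClock_of_eq_lindbladSemigroup hd hN κ hρ₀ hH L J hM
  · rintro ⟨⟨-, hM⟩, hcl⟩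
    cases κ
    · exact ⟨d * d, TickingClock.IsPeriodicClockChannel.exists_sameDynamics hd hN hM hcl⟩
    · exact ⟨d * d, TickingClock.IsCutOffClockChannel.exists_sameDynamics hd hN hM hcl⟩
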